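/- Let $A,B,C,D$ be four qubits and let $S_4\subset(\mathbb{C}^2)^{\otimes 4}$ be the subspace of vectors invariant under all permutations of the four tensor factors. A density matrix $\rho$ on $(\mathbb{C}^2)^{\otimes 4}$ is called symmetric if its range is contained in $S_4$, PPT if all its partial transposes $\rho^{T_S}$, $S\subseteq\{A,B,C,D\}$, are positive semidefinite, and (fully) separable if $\rho=\sum_i p_i\,\rho_A^{i}\otimes\rho_B^{i}\otimes\rho_C^{i}\otimes\rho_D^{i}$ (a finite sum) with $p_i\ge 0$, $\sum_i p_i=1$ and one-qubit density matrices $\rho_A^i,\dots,\rho_D^i$. Let $r$ denote the rank. For a set $X$ of density matrices, we say that a generic element of $X$ has a property if there is a real polynomial $f$ in the real and imaginary parts of the matrix entries such that $\{\rho\in X: f(\rho)\neq 0\}$ is dense in $X$ and all of its elements have the property. (1) If $\rho$ is a PPT symmetric four-qubit state and $r(\rho)\le 4$, or $r(\rho^{T_A})\le 4$, or $r(\rho^{T_{AB}})\le 3$, then $\rho$ is fully separable. (2) A generic PPT symmetric four-qubit state with $r(\rho^{T_A})\le 6$ is fully separable, and a generic PPT symmetric four-qubit state with $r(\rho^{T_{AB}})\le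 6$ is fully separable. The same holds rank by rank: for all $a,b,c$ with $b\le 6$ or $c\le 6$, a generic PPT symmetric four-qubit state with $(r(\rho),r(\rho^{T_A}),r(\rho^{T_{AB}}))=(a,b,c)$ is fully separable. -/

import Mathlib

namespace QubitStates

open scoped ComplexOrder

/-- Operators on `(ℂ²)^{⊗ N}`, as matrices in the computational basis: basis vectors are
indexed by bit strings `Fin N → Fin 2`. -/
abbrev Op (N : ℕ) : Type := Matrix (Fin N → Fin 2) (Fin N → Fin 2) ℂ

/-- Density matrices: positive semidefinite of trace one. -/
def IsState {I : Type*} [Fintype I] (ρ : Matrix I I ℂ) : Prop :=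
  ρ.PosSemidef ∧ ρ.trace = 1

/-- The tensor product `σ 0 ⊗ ⋯ ⊗ σ (N - 1)` of one-qubit operators. -/
def tensor {N : ℕ} (σ : Fin N → Matrix (Fin 2) (Fin 2) ℂ) : Op N :=
  Matrix.of fun x y => ∏ j, σ j (x j) (y j)

/-- Full separability: a finite convex combination of products of one-qubit states. -/
def FullySeparable {N : ℕ} (ρ : Op N) : Prop :=
  ∃ (n : ℕ) (p : Fin n → ℝ) (σ : Fin n → Fin N → Matrix (Fin 2) (Fin 2) ℂ),
    (∀ i, 0 ≤ p i) ∧ ∑ i, p i = 1 ∧ (∀ i j, IsState (σ i j)) ∧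
      ρ = ∑ i, (p i : ℂ) • tensor (σ i)

/-- The partial transpose of `ρ` with respect to the set `S` of parties: row and column bits
are exchanged at the positions in `S`. -/
def partialTranspose {N : ℕ} (S : Finset (Fin N)) (ρ : Op N) : Op N :=
  Matrix.of fun x y => ρ (S.piecewise y x) (S.piecewise x y)

/-- A state all of whose partial transposes are positive semidefinite. -/
def IsPPTState {N : ℕ} (ρ : Op N) : Prop :=
  IsState ρ ∧ ∀ S : Finset (Fin N), (partialTranspose S ρ).PosSemidef

/-- The symmetric subspace of `(ℂ²)^{⊗ N}`: the vectors invariant under all permutations of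
the tensor factors. -/
def symmetricSubspace (N : ℕ) : Submodule ℂ ((Fin N → Fin 2) → ℂ) where
  carrier := {v | ∀ (π : Equiv.Perm (Fin N)) (x : Fin N → Fin 2), v (x ∘ π) = v x}
  add_mem' := fun {v w} hv hw π x => by simp only [Pi.add_apply, hv π x, hw π x]
  zero_mem' := fun _ _ => rfl
  smul_mem' := fun c v hv π x => by simp only [Pi.smul_apply, hv π x]

/-- An operator is symmetric if its range is contained in the symmetric subspace. -/
def IsSymmetric {N : ℕ} (ρ : Op N) : Prop :=
  LinearMap.range ρ.mulVecLin ≤ symmetricSubspace N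

/-- The set of PPT symmetric states of `N` qubits. -/
def pptSymmetricStates (N : ℕ) : Set (Op N) :=
  {ρ | IsPPTState ρ ∧ IsSymmetric ρ}

/-- The rank of `ρ`, for four qubits `A, B, C, D = 0, 1, 2, 3`. -/
noncomputable def rk (ρ : Op 4) : ℕ := ρ.rank

/-- The rank of `ρ^{T_A}`. -/
noncomputable def rkA (ρ : Op 4) : ℕ := (partialTranspose {0} ρ).rank

/-- The rank of `ρ^{T_AB}`. -/
noncomputable def rkAB (ρ : Op 4) : ℕ := (partialTranspose {0, 1} ρ).rank

/-- The real coordinates of a complex matrix: real parts (left) and imaginary parts (right)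
of its entries. -/
def realCoords {I : Type*} (ρ : Matrix I I ℂ) : (I × I) ⊕ (I × I) → ℝ :=
  Sum.elim (fun e => (ρ e.1 e.2).re) (fun e => (ρ e.1 e.2).im)

/-- `P` holds for generic elements of the set `X` of matrices: there is a real polynomial `f` in
the real and imaginary parts of the entries such that the elements of `X` with `f ≠ 0` are
dense in `X`, and `P` holds for all of these. In other words, `P` holds on a relatively Zariski
open subset of `X` that is dense in the Euclidean topology. -/
def HoldsGenerically {I : Type*} (X : Set (Matrix I I ℂ)) (P : Matrix I I ℂ → Prop) : Prop :=
  ∃ f : MvPolynomial ((I × I) ⊕ (I × I)) ℝ,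
    X ⊆ closure {ρ | ρ ∈ X ∧ MvPolynomial.eval (realCoords ρ) f ≠ 0} ∧
      ∀ ρ ∈ X, MvPolynomial.eval (realCoords ρ) f ≠ 0 → P ρ

end QubitStates

/-! A symmetric state ρ is encoded as a Hermitian functional L on forms of bidegree (4, 4) in x and
y = conj x, with ρ s t the value on ∏ x_{s j} * ∏ y_{t j}. Positivity of ρ^{T_S} with |S| = j says
that L (q * conj q) ≥ 0 for q of bidegree (4 - j, j), the kernel of ρ^{T_S} turns into the
annihilated forms `annForms`, and products of four equal pure states are, up to scale, evaluations
at points z. The spaces of forms of bidegree (4, 0), (3, 1), (2, 2) have dimensions at least 5, 8,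
9, so r(ρ) ≤ 4, r(ρ^{T_A}) ≤ 6 or r(ρ^{T_AB}) ≤ 6 forces at least 1, 2 or 3 independent annihilated
forms there (`IsDegenerate`).

If all annihilated forms share a zero z, a multiple of the evaluation at z can be subtracted so that
L stays PPT and some kernel grows (`IsPPTFunctional.exists_subEval`). Degeneracy survives, so it
suffices that a nonzero functional without such z is never degenerate (`IsEdge.not_isDegenerate`).

Two mechanisms give this. First, l * q and conj l * q have the same squared modulus, so they are
annihilated together (`mul_mem_annForms_iff`). If l vanishes at a, then s ↦ L (q * s) depends only
on s(a), and for an edge functional this makes q itself annihilated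
(`mem_annForms_or_evalAt_eq_zero`): linear factors cancel. Secondly, among j + 1 forms of degree j
in y some combination acquires a linear factor in x, by a determinant
(`exists_combination_eq_lin_mul`). Combining and cancelling excludes nonzero annihilated forms of
bidegree (i, 0), (1, 1) and (2, 1) in turn, and then bounds the dimension by 1 in bidegree (3, 1)
and by 2 in bidegree (2, 2).

Every state in the given rank range is thus separable, not only the generic one, so the constant
polynomial 1 witnesses genericity. -/

namespace QubitStates

open MvPolynomial

/-! ### Bihomogeneous forms, conjugation and evaluation -/

/-- Polynomials in two pairs of variables `x₀, x₁` and `y₀, y₁`, where `y` plays the role of the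
complex conjugate of `x`. -/
abbrev BiPoly : Type := MvPolynomial (Fin 2 ⊕ Fin 2) ℂ

/-- The holomorphic variables. -/
noncomputable def xVar (k : Fin 2) : BiPoly := X (Sum.inl k)

/-- The antiholomorphic variables. -/
noncomputable def yVar (k : Fin 2) : BiPoly := X (Sum.inr k)

/-- Conjugation: conjugate the coefficients and exchange `x` and `y`. -/
noncomputable def conj : BiPoly →+* BiPoly :=
  ((rename Sum.swap : BiPoly →ₐ[ℂ] BiPoly) : BiPoly →+* BiPoly).comp (map (starRingEnd ℂ))

@[simp] lemma conj_C (a : ℂ) : conj (C a) = C (star a) := by simp [conj]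
@[simp] lemma conj_xVar (k : Fin 2) : conj (xVar k) = yVar k := by simp [conj, xVar, yVar]
@[simp] lemma conj_yVar (k : Fin 2) : conj (yVar k) = xVar k := by simp [conj, xVar, yVar]

@[simp] lemma conj_conj (p : BiPoly) : conj (conj p) = p := by
  have : conj.comp conj = RingHom.id BiPoly := by
    refine MvPolynomial.ringHom_ext (fun a => by simp) ?_
    rintro (k | k)
    · exact (congrArg conj (conj_xVar k)).trans (conj_yVar k)
    · exact (congrArg conj (conj_yVar k)).trans (conj_xVar k)
  exact congrArg (fun f : BiPoly →+* BiPoly => f p) this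

lemma conj_eq_zero {p : BiPoly} : conj p = 0 ↔ p = 0 :=
  ⟨fun h => by rw [← conj_conj p, h, map_zero], fun h => by rw [h, map_zero]⟩

/-- Forms of bidegree `(i, j)`. -/
noncomputable def forms (i j : ℕ) : Submodule ℂ BiPoly :=
  Submodule.span ℂ (Set.range xVar) ^ i * Submodule.span ℂ (Set.range yVar) ^ j

lemma mul_mem_forms {i j k l m n : ℕ} {p q : BiPoly} (hp : p ∈ forms i j) (hq : q ∈ forms k l)
    (hm : i + k = m := by omega) (hn : j + l = n := by omega) : p * q ∈ forms m n := by
  subst hm hn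
  have : forms (i + k) (j + l) = forms i j * forms k l := by
    simp only [forms, pow_add]; ring
  rw [this]
  exact Submodule.mul_mem_mul hp hq

lemma one_mem_forms : (1 : BiPoly) ∈ forms 0 0 := by
  simpa only [forms, pow_zero, mul_one] using (Submodule.mem_one (R := ℂ)).2 ⟨1, map_one _⟩

lemma C_mem_forms (a : ℂ) : (C a : BiPoly) ∈ forms 0 0 := by
  have := (forms 0 0).smul_mem a one_mem_forms
  rwa [smul_eq_C_mul, mul_one] at this

lemma C_mul_mem_forms {i j : ℕ} {p : BiPoly} (a : ℂ) (hp : p ∈ forms i j) :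
    C a * p ∈ forms i j := mul_mem_forms (C_mem_forms a) hp

lemma xVar_mem_forms (k : Fin 2) : xVar k ∈ forms 1 0 := by
  simpa [forms] using Submodule.subset_span (Set.mem_range_self k)

lemma yVar_mem_forms (k : Fin 2) : yVar k ∈ forms 0 1 := by
  simpa [forms] using Submodule.subset_span (Set.mem_range_self k)

lemma pow_mem_forms {i j : ℕ} {p : BiPoly} (hp : p ∈ forms i j) (n : ℕ) :
    p ^ n ∈ forms (n * i) (n * j) := by
  induction n with
  | zero => simpa using one_mem_forms
  | succ n ih => rw [pow_succ]; exact mul_mem_forms ih hp (by ring) (by ring)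

lemma pow_mem_forms_x {p : BiPoly} (hp : p ∈ forms 1 0) (n : ℕ) : p ^ n ∈ forms n 0 := by
  simpa using pow_mem_forms hp n

instance (i j : ℕ) : FiniteDimensional ℂ (forms i j) := by
  have hx : (Submodule.span ℂ (Set.range xVar)).FG := Submodule.fg_span (Set.finite_range _)
  have hy : (Submodule.span ℂ (Set.range yVar)).FG := Submodule.fg_span (Set.finite_range _)
  exact Module.Finite.iff_fg.2 ((hx.pow i).mul (hy.pow j))

lemma exists_eq_of_mem_span_range_mul {v : Fin 2 → BiPoly} {N : Submodule ℂ BiPoly} {p : BiPoly}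
    (hp : p ∈ Submodule.span ℂ (Set.range v) * N) :
    ∃ r ∈ N, ∃ s ∈ N, p = v 0 * r + v 1 * s := by
  induction hp using Submodule.mul_induction_on' with
  | mem_mul_mem a ha b hb =>
    obtain ⟨c, rfl⟩ := (Submodule.mem_span_range_iff_exists_fun ℂ).1 ha
    refine ⟨c 0 • b, N.smul_mem _ hb, c 1 • b, N.smul_mem _ hb, ?_⟩
    simp [Fin.sum_univ_two, add_mul]
  | add a _ b _ iha ihb =>
    obtain ⟨r, hr, s, hs, rfl⟩ := iha
    obtain ⟨r', hr', s', hs', rfl⟩ := ihb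
    exact ⟨r + r', N.add_mem hr hr', s + s', N.add_mem hs hs', by ring⟩

lemma exists_eq_xVar {i j : ℕ} {p : BiPoly} (hp : p ∈ forms (i + 1) j) :
    ∃ r ∈ forms i j, ∃ s ∈ forms i j, p = xVar 0 * r + xVar 1 * s := by
  apply exists_eq_of_mem_span_range_mul
  rw [forms, pow_succ, mul_comm (_ ^ i), mul_assoc] at hp
  exact hp

lemma exists_eq_yVar {i j : ℕ} {p : BiPoly} (hp : p ∈ forms i (j + 1)) :
    ∃ r ∈ forms i j, ∃ s ∈ forms i j, p = yVar 0 * r + yVar 1 * s := by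
  apply exists_eq_of_mem_span_range_mul
  rw [forms, pow_succ, mul_comm, mul_comm (_ ^ j), mul_assoc, mul_comm (_ ^ j)] at hp
  exact hp

lemma exists_eq_C {p : BiPoly} (hp : p ∈ forms 0 0) : ∃ c, p = C c := by
  simp only [forms, pow_zero, mul_one, Submodule.mem_one] at hp
  obtain ⟨c, rfl⟩ := hp
  exact ⟨c, rfl⟩

/-- Induction principle for membership in `forms i j`. -/
lemma forms_induction {P : ℕ → ℕ → BiPoly → Prop} (hC : ∀ c, P 0 0 (C c))
    (hadd : ∀ i j p q, P i j p → P i j q → P i j (p + q))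
    (hx : ∀ i j k p, P i j p → P (i + 1) j (xVar k * p))
    (hy : ∀ j k p, P 0 j p → P 0 (j + 1) (yVar k * p)) {i j : ℕ} {p : BiPoly}
    (hp : p ∈ forms i j) : P i j p := by
  induction i generalizing p with
  | zero =>
    induction j generalizing p with
    | zero => obtain ⟨c, rfl⟩ := exists_eq_C hp; exact hC c
    | succ j ih =>
      obtain ⟨r, hr, s, hs, rfl⟩ := exists_eq_yVar hp
      exact hadd _ _ _ _ (hy _ _ _ (ih hr)) (hy _ _ _ (ih hs))
  | succ i ih =>
    obtain ⟨r, hr, s, hs, rfl⟩ := exists_eq_xVar hp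
    exact hadd _ _ _ _ (hx _ _ _ _ (ih hr)) (hx _ _ _ _ (ih hs))

lemma conj_mem_forms {i j : ℕ} {p : BiPoly} (hp : p ∈ forms i j) : conj p ∈ forms j i := by
  refine forms_induction (P := fun i j p => conj p ∈ forms j i) (fun c => ?_)
    (fun i j p q hp hq => ?_) (fun i j k p hp => ?_) (fun j k p hp => ?_) hp
  · simpa using C_mem_forms _
  · rw [map_add]; exact Submodule.add_mem _ hp hq
  · rw [map_mul, conj_xVar]; exact mul_mem_forms (yVar_mem_forms k) hp
  · rw [map_mul, conj_yVar]; exact mul_mem_forms (xVar_mem_forms k) hp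

/-- Evaluation at the point `x = z`, `y = conj z`. -/
noncomputable def evalAt (z : Fin 2 → ℂ) : BiPoly →ₐ[ℂ] ℂ :=
  aeval (Sum.elim z (fun k => star (z k)))

/-- Evaluation of the `x` variables only. -/
noncomputable def evalX (a : Fin 2 → ℂ) : BiPoly →ₐ[ℂ] BiPoly :=
  aeval (Sum.elim (fun k => C (a k)) yVar)

@[simp] lemma evalAt_xVar (z : Fin 2 → ℂ) (k : Fin 2) : evalAt z (xVar k) = z k := by
  simp [evalAt, xVar]
@[simp] lemma evalAt_yVar (z : Fin 2 → ℂ) (k : Fin 2) : evalAt z (yVar k) = star (z k) := by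
  simp [evalAt, yVar]
@[simp] lemma evalAt_C (z : Fin 2 → ℂ) (c : ℂ) : evalAt z (C c) = c := by
  simp [evalAt]
@[simp] lemma evalX_xVar (z : Fin 2 → ℂ) (k : Fin 2) : evalX z (xVar k) = C (z k) := by
  simp [evalX, xVar]
@[simp] lemma evalX_yVar (z : Fin 2 → ℂ) (k : Fin 2) : evalX z (yVar k) = yVar k := by
  simp [evalX, yVar]
@[simp] lemma evalX_C (z : Fin 2 → ℂ) (c : ℂ) : evalX z (C c) = C c := by
  simp [evalX]

lemma evalAt_conj (z : Fin 2 → ℂ) (p : BiPoly) : evalAt z (conj p) = star (evalAt z p) := by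
  have : ((evalAt z : BiPoly →+* ℂ).comp conj) =
      (starRingEnd ℂ).comp (evalAt z : BiPoly →+* ℂ) := by
    refine MvPolynomial.ringHom_ext (fun a => by simp) ?_
    rintro (k | k)
    · change evalAt z (conj (xVar k)) = star (evalAt z (xVar k))
      simp
    · change evalAt z (conj (yVar k)) = star (evalAt z (yVar k))
      simp
  exact congrArg (fun f : BiPoly →+* ℂ => f p) this

lemma evalX_of_mem_forms_zero {a : Fin 2 → ℂ} {j : ℕ} {p : BiPoly} (hp : p ∈ forms 0 j) :
    evalX a p = p := by
  refine forms_induction (P := fun i j p => i = 0 → evalX a p = p) (fun c => ?_)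
    (fun i j p q hp hq h => ?_) (fun i j k p hp => ?_) (fun j k p hp => ?_) hp rfl
  · simp
  · rw [map_add, hp h, hq h]
  · simp
  · intro _; rw [map_mul, hp rfl, evalX_yVar]

lemma evalX_of_mem_forms_x {a : Fin 2 → ℂ} {i : ℕ} {p : BiPoly} (hp : p ∈ forms i 0) :
    evalX a p = C (evalAt a p) := by
  refine forms_induction (P := fun i j p => j = 0 → evalX a p = C (evalAt a p)) (fun c => ?_)
    (fun i j p q hp hq h => ?_) (fun i j k p hp h => ?_) (fun j k p hp => ?_) hp rfl
  · simp
  · simp [hp h, hq h]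
  · simp [hp h]
  · simp

lemma evalAt_evalX (a : Fin 2 → ℂ) (p : BiPoly) : evalAt a (evalX a p) = evalAt a p := by
  have : ((evalAt a).comp (evalX a)) = evalAt a := by
    refine MvPolynomial.algHom_ext ?_
    rintro (k | k)
    · change evalAt a (evalX a (xVar k)) = evalAt a (xVar k); simp
    · change evalAt a (evalX a (yVar k)) = evalAt a (yVar k); simp
  exact congrArg (fun f : BiPoly →ₐ[ℂ] ℂ => f p) this

/-! ### Linear factors and roots -/

/-- The linear form in `x` vanishing at `a`. -/
noncomputable def lin (a : Fin 2 → ℂ) : BiPoly := C (a 1) * xVar 0 - C (a 0) * xVar 1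

lemma lin_mem_forms (a : Fin 2 → ℂ) : lin a ∈ forms 1 0 :=
  Submodule.sub_mem _ (C_mul_mem_forms _ (xVar_mem_forms 0)) (C_mul_mem_forms _ (xVar_mem_forms 1))

@[simp] lemma evalX_lin (a : Fin 2 → ℂ) : evalX a (lin a) = 0 := by
  simp [lin]; ring

/-- A linear form that equals `1` at a given nonzero point, complementary to `lin a`. -/
lemma exists_complement {a : Fin 2 → ℂ} (ha : a ≠ 0) :
    ∃ m ∈ forms 1 0, evalX a m = 1 ∧
      ∀ k, ∃ α : ℂ, xVar k = C α * lin a + C (a k) * m := by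
  by_cases h0 : a 0 = 0
  · have h1 : a 1 ≠ 0 := fun h1 => ha (by ext k; fin_cases k <;> simp [h0, h1])
    have hC : (C (a 1) : BiPoly) * C (a 1)⁻¹ = 1 := by rw [← C_mul, mul_inv_cancel₀ h1, C_1]
    refine ⟨C (a 1)⁻¹ * xVar 1, C_mul_mem_forms _ (xVar_mem_forms 1), ?_, fun k => ?_⟩
    · rw [map_mul, evalX_C, evalX_xVar, mul_comm, hC]
    · fin_cases k
      · refine ⟨(a 1)⁻¹, ?_⟩
        simp only [lin, h0, C_0, Fin.zero_eta]
        linear_combination (-xVar 0) * hC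
      · refine ⟨0, ?_⟩
        simp only [C_0, Fin.mk_one]
        linear_combination (-xVar 1) * hC
  · have hC : (C (a 0) : BiPoly) * C (a 0)⁻¹ = 1 := by rw [← C_mul, mul_inv_cancel₀ h0, C_1]
    refine ⟨C (a 0)⁻¹ * xVar 0, C_mul_mem_forms _ (xVar_mem_forms 0), ?_, fun k => ?_⟩
    · rw [map_mul, evalX_C, evalX_xVar, mul_comm, hC]
    · fin_cases k
      · refine ⟨0, ?_⟩
        simp only [C_0, Fin.zero_eta]
        linear_combination (-xVar 0) * hC
      · refine ⟨-(a 0)⁻¹, ?_⟩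
        simp only [lin, C_neg, Fin.mk_one]
        linear_combination (-xVar 1) * hC

/-- `lin a` and `m` span the linear forms in x, so modulo `lin a` a form is its restriction to x =
a, made homogeneous again by a power of `m`. -/
lemma exists_lin_mul_add {a : Fin 2 → ℂ} {m : BiPoly} (hm : m ∈ forms 1 0)
    (hx : ∀ k, ∃ α : ℂ, xVar k = C α * lin a + C (a k) * m)
    {i j : ℕ} {p : BiPoly} (hp : p ∈ forms (i + 1) j) :
    ∃ r ∈ forms i j, p = lin a * r + m ^ (i + 1) * evalX a p := by
  choose α hα using hx
  have hα0 := hα 0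
  have hα1 := hα 1
  induction i generalizing p with
  | zero =>
    obtain ⟨r, hr, s, hs, rfl⟩ := exists_eq_xVar hp
    refine ⟨C (α 0) * r + C (α 1) * s,
      Submodule.add_mem _ (C_mul_mem_forms _ hr) (C_mul_mem_forms _ hs), ?_⟩
    simp only [map_add, map_mul, evalX_xVar, evalX_of_mem_forms_zero hr,
      evalX_of_mem_forms_zero hs]
    linear_combination r * hα0 + s * hα1
  | succ i ih =>
    obtain ⟨r, hr, s, hs, rfl⟩ := exists_eq_xVar hp
    obtain ⟨r', hr', hrm⟩ := ih hr
    obtain ⟨s', hs', hsm⟩ := ih hs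
    refine ⟨C (α 0) * r + C (α 1) * s + m * (C (a 0) * r' + C (a 1) * s'), ?_, ?_⟩
    · refine Submodule.add_mem _ (Submodule.add_mem _ (C_mul_mem_forms _ hr)
        (C_mul_mem_forms _ hs)) (mul_mem_forms hm (Submodule.add_mem _ (C_mul_mem_forms _ hr')
        (C_mul_mem_forms _ hs')))
    · simp only [map_add, map_mul, evalX_xVar]
      linear_combination r * hα0 + s * hα1 + C (a 0) * m * hrm + C (a 1) * m * hsm

/-- A form vanishing on the line `x = a` is divisible by `lin a`. -/
lemma exists_eq_lin_mul {a : Fin 2 → ℂ} (ha : a ≠ 0) {i j : ℕ} {p : BiPoly}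
    (hp : p ∈ forms (i + 1) j) (h : evalX a p = 0) : ∃ r ∈ forms i j, p = lin a * r := by
  obtain ⟨m, hm, -, hx⟩ := exists_complement ha
  obtain ⟨r, hr, e⟩ := exists_lin_mul_add hm hx hp
  exact ⟨r, hr, by rw [e, h]; ring⟩

/-- Dehomogenize at x₁ = 1. Unless (1, 0) is already a zero, the leading coefficient survives, so
the polynomial has degree d + 1 and a complex root. -/
lemma exists_root {d : ℕ} {p : BiPoly} (hp : p ∈ forms (d + 1) 0) :
    ∃ a ≠ 0, evalAt a p = 0 := by
  let φ : BiPoly →ₐ[ℂ] Polynomial ℂ := aeval (Sum.elim ![Polynomial.X, 1] 0)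
  have hφ0 : φ (xVar 0) = Polynomial.X := by simp [φ, xVar]
  have hφ1 : φ (xVar 1) = 1 := by simp [φ, xVar]
  have hφC : ∀ c, φ (C c) = Polynomial.C c := fun c => by simp [φ]
  have hdeg : ∀ {i j : ℕ} {q : BiPoly}, q ∈ forms i j → (φ q).natDegree ≤ i := by
    intro i j q hq
    refine forms_induction (P := fun i j q => (φ q).natDegree ≤ i) (fun c => ?_)
      (fun i j p q hp hq => ?_) (fun i j k p hp => ?_) (fun j k p hp => ?_) hq
    · simp [hφC]
    · rw [map_add]; exact Polynomial.natDegree_add_le_of_degree_le hp hq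
    · rw [map_mul]
      refine Polynomial.natDegree_mul_le.trans ?_
      rw [add_comm i 1]
      refine add_le_add ?_ hp
      fin_cases k
      · simp [hφ0]
      · simp [hφ1]
    · simp [φ, yVar]
  have heval : ∀ {i j : ℕ} {q : BiPoly} (t : ℂ), q ∈ forms i j → j = 0 →
      (φ q).eval t = evalAt ![t, 1] q := by
    intro i j q t hq
    refine forms_induction (P := fun i j q => j = 0 → (φ q).eval t = evalAt ![t, 1] q)
      (fun c => ?_) (fun i j p q hp hq h => ?_) (fun i j k p hp h => ?_) (fun j k p hp => ?_) hq
    · simp [hφC]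
    · simp [hp h, hq h]
    · simp only [map_mul, Polynomial.eval_mul, hp h, evalAt_xVar]
      fin_cases k
      · simp [hφ0]
      · simp [hφ1]
    · simp
  have ha : (![1, 0] : Fin 2 → ℂ) ≠ 0 := fun h => by simpa using congrFun h 0
  obtain ⟨r, hr, e⟩ := exists_lin_mul_add (m := xVar 0) (a := ![1, 0]) (xVar_mem_forms 0)
    (fun k => by
      fin_cases k
      · exact ⟨0, by simp⟩
      · exact ⟨-1, by simp [lin]⟩) hp
  by_cases h0 : evalAt ![1, 0] p = 0
  · exact ⟨_, ha, h0⟩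
  rw [evalX_of_mem_forms_x hp] at e
  have hnd : (φ p).natDegree = d + 1 := by
    rw [e]
    simp only [map_add, map_mul, map_pow, hφ0, hφC, lin]
    simp only [map_sub, map_mul, hφ0, hφ1, hφC, Matrix.cons_val_zero, Matrix.cons_val_one]
    rw [Polynomial.natDegree_add_eq_right_of_natDegree_lt]
    · rw [mul_comm, Polynomial.natDegree_C_mul_X_pow _ _ h0]
    · rw [mul_comm (_ ^ _), Polynomial.natDegree_C_mul_X_pow _ _ h0]
      simpa using Nat.lt_succ_of_le (hdeg hr)
  obtain ⟨t, ht⟩ := IsAlgClosed.exists_root (φ p) (by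
    intro h; have := Polynomial.natDegree_eq_zero_iff_degree_le_zero.2 h.le; omega)
  refine ⟨![t, 1], fun h => by simpa using congrFun h 1, ?_⟩
  rw [← heval t hp rfl]; exact ht

/-! ### Combinations that acquire a linear factor -/

lemma exists_eq_sum_yVar {d j : ℕ} {u : BiPoly} (hu : u ∈ forms d j) :
    ∃ c : ℕ → BiPoly, (∀ b, c b ∈ forms d 0) ∧
      u = ∑ b ∈ Finset.range (j + 1), c b * (yVar 0 ^ b * yVar 1 ^ (j - b)) := by
  induction j generalizing u with
  | zero => exact ⟨fun _ => u, fun _ => hu, by simp⟩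
  | succ j ih =>
    obtain ⟨r, hr, s, hs, rfl⟩ := exists_eq_yVar hu
    obtain ⟨c, hc, rfl⟩ := ih hr
    obtain ⟨c', hc', rfl⟩ := ih hs
    -- The factor y₀ shifts the index b by one, the factor y₁ keeps it; the conditionals remove the
    -- two boundary terms.
    refine ⟨fun b => (if b = 0 then 0 else c (b - 1)) + (if b = j + 1 then 0 else c' b),
      fun b => ?_, ?_⟩
    · refine Submodule.add_mem _ ?_ ?_
      · split_ifs
        exacts [Submodule.zero_mem _, hc _]
      · split_ifs
        exacts [Submodule.zero_mem _, hc' _]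
    · simp only [add_mul, Finset.sum_add_distrib]
      rw [Finset.sum_range_succ' (fun b => (if b = 0 then 0 else c (b - 1)) * _),
        Finset.sum_range_succ (fun b => (if b = j + 1 then 0 else c' b) * _)]
      simp only [Finset.mul_sum]
      congr 1
      · simp only [↓reduceIte, zero_mul, add_zero]
        refine Finset.sum_congr rfl fun b _ => ?_
        rw [if_neg (Nat.succ_ne_zero b), Nat.add_sub_cancel, Nat.add_sub_add_right, pow_succ]
        ring
      · simp only [↓reduceIte, zero_mul, add_zero]
        refine Finset.sum_congr rfl fun b hb => ?_
        have hb' := Finset.mem_range.1 hb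
        rw [if_neg hb'.ne, Nat.succ_sub (Nat.lt_succ_iff.1 hb'), pow_succ]
        ring

lemma prod_mem_forms {ι : Type*} (s : Finset ι) {f : ι → BiPoly} {d : ι → ℕ}
    (h : ∀ k, f k ∈ forms (d k) 0) : ∏ k ∈ s, f k ∈ forms (∑ k ∈ s, d k) 0 := by
  classical
  induction s using Finset.induction_on with
  | empty => simpa using one_mem_forms
  | insert k s hk ih =>
    rw [Finset.prod_insert hk, Finset.sum_insert hk]
    exact mul_mem_forms (h k) ih

/-- Among `j + 1` forms of degree `j` in `y`, a nontrivial combination (after equalizing the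
degrees in `x`) becomes divisible by a linear form in `x`. -/
lemma exists_combination_eq_lin_mul {i j : ℕ} (u : Fin (j + 1) → BiPoly) (d e : Fin (j + 1) → ℕ)
    (hde : ∀ k, d k + e k = i + 1) (hd : 0 < ∑ k, d k) (hu : ∀ k, u k ∈ forms (d k) j) :
    ∃ a ≠ 0, ∃ m ∈ forms 1 0, evalX a m = 1 ∧ ∃ c : Fin (j + 1) → ℂ, c ≠ 0 ∧
      ∃ r ∈ forms i j, ∑ k, C (c k) * m ^ e k * u k = lin a * r := by
  choose f hf hfu using fun k => exists_eq_sum_yVar (hu k)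
  -- The square matrix of coefficients in the y-monomials. Its determinant is a form in x of
  -- positive degree; at a root a the rows become dependent.
  let M : Matrix (Fin (j + 1)) (Fin (j + 1)) BiPoly := Matrix.of fun k b => f k b
  have hdet : M.det ∈ forms (∑ k, d k) 0 := by
    rw [Matrix.det_apply]
    refine Submodule.sum_mem _ fun σ _ => ?_
    have h1 : ∏ k, M (σ k) k ∈ forms (∑ k, d k) 0 := by
      rw [← Equiv.sum_comp σ d]
      exact prod_mem_forms Finset.univ fun k => hf (σ k) k
    rcases Int.units_eq_one_or (Equiv.Perm.sign σ) with h | h <;> rw [h]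
    · simpa using h1
    · simpa using h1
  obtain ⟨n, hn⟩ := Nat.exists_eq_succ_of_ne_zero hd.ne'
  rw [hn] at hdet
  obtain ⟨a, ha, hroot⟩ := exists_root hdet
  obtain ⟨m, hm, hma, -⟩ := exists_complement ha
  have hroot' : (M.map (evalAt a)).det = 0 := by
    rw [← hroot, AlgHom.map_det]; rfl
  obtain ⟨c, hc, hcM⟩ := Matrix.exists_vecMul_eq_zero_iff.2 hroot'
  refine ⟨a, ha, m, hm, hma, c, hc, ?_⟩
  refine exists_eq_lin_mul ha (Submodule.sum_mem _ fun k _ => ?_) ?_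
  · exact mul_mem_forms (C_mul_mem_forms _ (pow_mem_forms_x hm (e k))) (hu k)
      (by have := hde k; omega)
  · have h2 : ∀ k, evalX a (u k) =
        ∑ b : Fin (j + 1), C (evalAt a (f k b)) * (yVar 0 ^ (b : ℕ) * yVar 1 ^ (j - b)) := by
      intro k
      conv_lhs => rw [hfu k]
      rw [map_sum, Finset.sum_range]
      refine Finset.sum_congr rfl fun b _ => ?_
      rw [map_mul, evalX_of_mem_forms_x (hf k b)]
      simp
    simp only [map_sum, map_mul, map_pow, hma, one_pow, mul_one, h2, evalX_C, Finset.mul_sum]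
    rw [Finset.sum_comm]
    refine Finset.sum_eq_zero fun b _ => ?_
    have h3 : ∑ k, c k * evalAt a (f k b) = 0 := congrFun hcM b
    have h4 : ∑ k, (C (c k) : BiPoly) * C (evalAt a (f k b)) = 0 := by
      rw [← C_0, ← h3, map_sum]
      simp only [C_mul]
    simp only [← mul_assoc]
    rw [← Finset.sum_mul, ← Finset.sum_mul, h4, zero_mul, zero_mul]

lemma exists_pencil_eq_lin_mul {i d e : ℕ} {u v : BiPoly} (hde : d + e = i + 1)
    (hu : u ∈ forms (i + 1) 1) (hv : v ∈ forms d 1) :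
    ∃ a ≠ 0, ∃ m ∈ forms 1 0, evalX a m = 1 ∧ ∃ α β : ℂ, (α ≠ 0 ∨ β ≠ 0) ∧
      ∃ r ∈ forms i 1, C α * u + C β * m ^ e * v = lin a * r := by
  obtain ⟨a, ha, m, hm, hma, c, hc, r, hr, h⟩ := exists_combination_eq_lin_mul (i := i)
    ![u, v] ![i + 1, d] ![0, e] (fun k => by fin_cases k <;> simp [hde]) (by simp [Fin.sum_univ_two])
    (fun k => by fin_cases k <;> simp [hu, hv])
  refine ⟨a, ha, m, hm, hma, c 0, c 1, ?_, r, hr, by simpa [Fin.sum_univ_two] using h⟩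
  by_contra! hzero
  exact hc (by ext k; fin_cases k <;> simp [hzero])

lemma exists_net_eq_lin_mul {i d d' e e' : ℕ} {u v w : BiPoly} (hde : d + e = i + 1)
    (hde' : d' + e' = i + 1)
    (hu : u ∈ forms (i + 1) 2) (hv : v ∈ forms d 2) (hw : w ∈ forms d' 2) :
    ∃ a ≠ 0, ∃ m ∈ forms 1 0, evalX a m = 1 ∧ ∃ α β γ : ℂ, (α ≠ 0 ∨ β ≠ 0 ∨ γ ≠ 0) ∧
      ∃ r ∈ forms i 2, C α * u + C β * m ^ e * v + C γ * m ^ e' * w = lin a * r := by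
  obtain ⟨a, ha, m, hm, hma, c, hc, r, hr, h⟩ := exists_combination_eq_lin_mul (i := i)
    ![u, v, w] ![i + 1, d, d'] ![0, e, e'] (fun k => by fin_cases k <;> simp [hde, hde'])
    (by simp [Fin.sum_univ_succ])
    (fun k => by fin_cases k <;> simp [hu, hv, hw])
  refine ⟨a, ha, m, hm, hma, c 0, c 1, c 2, ?_, r, hr, by simpa [Fin.sum_univ_three] using h⟩
  by_contra! hzero
  exact hc (by ext k; fin_cases k <;> simp [hzero])

/-! ### PPT functionals and annihilated forms -/

/-- Functionals on bihomogeneous polynomials of bidegree `(4, 4)` that are Hermitian and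
nonnegative on the squared moduli of forms of bidegree `(4, 0)`, `(3, 1)` and `(2, 2)`. -/
structure IsPPTFunctional (L : BiPoly →ₗ[ℂ] ℂ) : Prop where
  map_conj : ∀ p, L (conj p) = star (L p)
  nonneg : ∀ i j, i + j = 4 → j ≤ 2 → ∀ q ∈ forms i j, 0 ≤ (L (q * conj q)).re

/-- The forms of bidegree `(i, j)` annihilated by `L`. -/
def annForms (L : BiPoly →ₗ[ℂ] ℂ) (i j : ℕ) : Submodule ℂ BiPoly where
  carrier := {q | q ∈ forms i j ∧ ∀ p ∈ forms (4 - i) (4 - j), L (q * p) = 0}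
  add_mem' := fun {a b} ha hb => ⟨Submodule.add_mem _ ha.1 hb.1, fun p hp => by
    rw [add_mul, map_add, ha.2 p hp, hb.2 p hp, add_zero]⟩
  zero_mem' := ⟨Submodule.zero_mem _, fun p _ => by rw [zero_mul, map_zero]⟩
  smul_mem' := fun c q hq => ⟨Submodule.smul_mem _ _ hq.1, fun p hp => by
    rw [smul_mul_assoc, map_smul, hq.2 p hp, smul_zero]⟩

section

variable {L : BiPoly →ₗ[ℂ] ℂ}

lemma map_C_mul (L : BiPoly →ₗ[ℂ] ℂ) (c : ℂ) (p : BiPoly) : L (C c * p) = c * L p := by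
  rw [← smul_eq_C_mul, map_smul, smul_eq_mul]

lemma C_mul_mem_annForms {i j : ℕ} {q : BiPoly} (c : ℂ) (hq : q ∈ annForms L i j) :
    C c * q ∈ annForms L i j := by
  rw [← smul_eq_C_mul]; exact Submodule.smul_mem _ _ hq

lemma mul_mem_annForms {i j k n i' j' : ℕ} {p q : BiPoly} (hp : p ∈ forms k n)
    (hq : q ∈ annForms L i j) (hi : k + i = i' := by omega) (hj : n + j = j' := by omega)
    (hi' : i' ≤ 4 := by omega) (hj' : j' ≤ 4 := by omega) : p * q ∈ annForms L i' j' := by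
  refine ⟨mul_mem_forms hp hq.1, fun s hs => ?_⟩
  rw [mul_comm p, mul_assoc]
  exact hq.2 _ (mul_mem_forms hp hs)

lemma mem_annForms_of_xVar_mul {i j : ℕ} {q : BiPoly} (hi : i ≤ 3) (hq : q ∈ forms i j)
    (h : ∀ k, xVar k * q ∈ annForms L (i + 1) j) : q ∈ annForms L i j := by
  refine ⟨hq, fun s hs => ?_⟩
  rw [show 4 - i = (4 - (i + 1)) + 1 by omega] at hs
  obtain ⟨r, hr, t, ht, rfl⟩ := exists_eq_xVar hs
  rw [show q * (xVar 0 * r + xVar 1 * t) = xVar 0 * q * r + xVar 1 * q * t by ring, map_add,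
    (h 0).2 r hr, (h 1).2 t ht, add_zero]

namespace IsPPTFunctional

lemma conj_mem_annForms (hL : IsPPTFunctional L) {i j : ℕ} {q : BiPoly}
    (hq : q ∈ annForms L i j) : conj q ∈ annForms L j i := by
  refine ⟨conj_mem_forms hq.1, fun p hp => ?_⟩
  rw [← conj_conj p, ← map_mul, hL.map_conj, hq.2 _ (conj_mem_forms hp), star_zero]

/-- Expansion of the Hermitian form attached to `L`. -/
lemma re_map_add (hL : IsPPTFunctional L) (s q : BiPoly) (c : ℂ) :
    (L ((s + C c * q) * conj (s + C c * q))).re =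
      (L (s * conj s)).re + 2 * (c * L (q * conj s)).re
        + Complex.normSq c * (L (q * conj q)).re := by
  have h1 : (s + C c * q) * conj (s + C c * q) = s * conj s + C c * (q * conj s) +
      C (star c) * (s * conj q) + C (c * star c) * (q * conj q) := by
    rw [map_add, map_mul, conj_C, C_mul]; ring
  have h2 : L (s * conj q) = star (L (q * conj s)) := by
    rw [← hL.map_conj, map_mul conj, conj_conj, mul_comm]
  have h3 : c * star c = (Complex.normSq c : ℂ) := Complex.mul_conj c
  have h4 : star c * star (L (q * conj s)) = star (c * L (q * conj s)) := by
    rw [star_mul, mul_comm]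
  rw [h1, map_add, map_add, map_add, map_C_mul, map_C_mul, map_C_mul, h2, h3, h4]
  simp only [Complex.add_re, Complex.re_ofReal_mul]
  have h5 : (star (c * L (q * conj s))).re = (c * L (q * conj s)).re := Complex.conj_re _
  rw [h5]; ring

/-- Degenerate Cauchy–Schwarz: perturbing conj p by a multiple of q changes its square only by a
linear term in L (q * p), which nonnegativity forces to vanish. -/
lemma mem_annForms_of_map_mul_conj (hL : IsPPTFunctional L) {i j : ℕ} (hij : i + j = 4)
    (hj : j ≤ 2) {q : BiPoly} (hq : q ∈ forms i j) (h : (L (q * conj q)).re = 0) :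
    q ∈ annForms L i j := by
  refine ⟨hq, fun p hp => ?_⟩
  rw [show 4 - i = j by omega, show 4 - j = i by omega] at hp
  have hs := conj_mem_forms hp
  set b := L (q * p) with hb
  have key : ∀ n : ℝ, 0 ≤ (L (conj p * conj (conj p))).re - 2 * n * Complex.normSq b := by
    intro n
    have := hL.nonneg i j hij hj (conj p + C (-(n : ℂ) * star b) * q)
      (Submodule.add_mem _ hs (C_mul_mem_forms _ hq))
    rw [hL.re_map_add, h, conj_conj, ← hb] at this
    have h2 : (-(n : ℂ) * star b * b).re = -n * Complex.normSq b := by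
      have : -(n : ℂ) * star b * b = ((-n * Complex.normSq b : ℝ) : ℂ) := by
        rw [mul_assoc, mul_comm (star b)]
        have : b * star b = (Complex.normSq b : ℂ) := Complex.mul_conj b
        rw [this]; push_cast; ring
      rw [this, Complex.ofReal_re]
    rw [h2] at this
    rw [conj_conj]
    linarith
  by_contra hb0
  have hpos : 0 < Complex.normSq b := Complex.normSq_pos.2 hb0
  have := key (((L (conj p * conj (conj p))).re + 1) / (2 * Complex.normSq b))
  have h3 : 2 * (((L (conj p * conj (conj p))).re + 1) / (2 * Complex.normSq b)) *
      Complex.normSq b = (L (conj p * conj (conj p))).re + 1 := by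
    field_simp
  linarith

lemma re_map_mul_conj_of_mem_annForms {i j : ℕ} (hij : i + j = 4) {q : BiPoly}
    (hq : q ∈ annForms L i j) : (L (q * conj q)).re = 0 := by
  rw [hq.2 _ (by
    have := conj_mem_forms hq.1
    rwa [show 4 - i = j by omega, show 4 - j = i by omega]), Complex.zero_re]

/-- A linear factor of an annihilated form may be replaced by its conjugate. -/
lemma mul_mem_annForms_iff (hL : IsPPTFunctional L) {i j : ℕ} (hij : i + j = 3) (hj : j ≤ 1)
    {l q : BiPoly} (hl : l ∈ forms 1 0) (hq : q ∈ forms i j) :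
    l * q ∈ annForms L (i + 1) j ↔ conj l * q ∈ annForms L i (j + 1) := by
  -- This identity links the kernels of different partial transposes.
  have e : l * q * conj (l * q) = conj l * q * conj (conj l * q) := by
    simp only [map_mul, conj_conj]; ring
  constructor
  · intro h
    refine hL.mem_annForms_of_map_mul_conj (by omega) (by omega)
      (mul_mem_forms (conj_mem_forms hl) hq) ?_
    rw [← e]; exact re_map_mul_conj_of_mem_annForms (by omega) h
  · intro h
    refine hL.mem_annForms_of_map_mul_conj (by omega) (by omega) (mul_mem_forms hl hq) ?_
    rw [e]; exact re_map_mul_conj_of_mem_annForms (by omega) h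

end IsPPTFunctional

lemma evalX_mem_forms {i j : ℕ} {a : Fin 2 → ℂ} {p : BiPoly} (hp : p ∈ forms i j) :
    evalX a p ∈ forms 0 j := by
  refine forms_induction (P := fun i j p => evalX a p ∈ forms 0 j) (fun c => ?_)
    (fun i j p q hp hq => ?_) (fun i j k p hp => ?_) (fun j k p hp => ?_) hp
  · simpa using C_mem_forms c
  · rw [map_add]; exact Submodule.add_mem _ hp hq
  · rw [map_mul, evalX_xVar]; exact C_mul_mem_forms _ hp
  · rw [map_mul, evalX_yVar]; exact mul_mem_forms (yVar_mem_forms k) hp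

/-- If both `lin a * q` and its conjugate variant are annihilated, then `s ↦ L (q * s)` is a
multiple of evaluation at `a`. So either it vanishes, or `a` is a zero of every annihilated form
of bidegree at most `(4 - i, 4 - j)`. -/
lemma mem_annForms_or_evalAt_eq_zero {i j : ℕ} (hi : i ≤ 3) (hj : j ≤ 3) {a : Fin 2 → ℂ}
    (ha : a ≠ 0) {q : BiPoly} (hq : q ∈ forms i j) (h : lin a * q ∈ annForms L (i + 1) j)
    (h' : conj (lin a) * q ∈ annForms L i (j + 1)) :
    q ∈ annForms L i j ∨
      ∀ k n, k ≤ 4 - i → n ≤ 4 - j → ∀ t ∈ annForms L k n, evalAt a t = 0 := by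
  obtain ⟨m, hm, hma, hx⟩ := exists_complement ha
  have hma' : evalAt a m = 1 := by rw [← evalAt_evalX, hma, map_one]
  set κ := L (q * (m ^ (4 - i) * conj m ^ (4 - j))) with hκ
  -- Modulo `lin a` and its conjugate, s reduces to s(a) times a product of powers of `m` and `conj
  -- m`; `h` and `h'` kill the two remainders.
  have key : ∀ s ∈ forms (4 - i) (4 - j), L (q * s) = evalAt a s * κ := by
    intro s hs
    obtain ⟨n, hn⟩ : ∃ n, 4 - i = n + 1 := ⟨3 - i, by omega⟩
    obtain ⟨n', hn'⟩ : ∃ n, 4 - j = n + 1 := ⟨3 - j, by omega⟩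
    rw [hn, hn'] at hs
    obtain ⟨r, hr, e⟩ := exists_lin_mul_add hm hx hs
    have ht := conj_mem_forms (evalX_mem_forms (a := a) hs)
    obtain ⟨r', hr', e'⟩ := exists_lin_mul_add hm hx ht
    rw [evalX_of_mem_forms_x ht, evalAt_conj, evalAt_evalX] at e'
    have e'' := congrArg conj e'
    simp only [conj_conj, map_add, map_mul, map_pow, conj_C, star_star] at e''
    have e3 : q * s = lin a * q * r + conj (lin a) * q * (m ^ (n + 1) * conj r') +
        C (evalAt a s) * (q * (m ^ (4 - i) * conj m ^ (4 - j))) := by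
      rw [hn, hn']
      linear_combination q * e + q * m ^ (n + 1) * e''
    rw [e3, map_add, map_add, map_C_mul, h.2 _ (by convert hr using 2; omega),
      h'.2 _ (mul_mem_forms (pow_mem_forms_x hm _) (conj_mem_forms hr')), zero_add, zero_add]
  by_cases h0 : κ = 0
  · exact Or.inl ⟨hq, fun s hs => by rw [key s hs, h0, mul_zero]⟩
  · refine Or.inr fun k n hk hn t ht => ?_
    -- Padding t to bidegree (4 - i, 4 - j) does not change its value at a, as `m` is 1 there; L
    -- kills the padded product with q because t is annihilated.
    have hmem : m ^ (4 - i - k) * conj m ^ (4 - j - n) ∈ forms (4 - i - k) (4 - j - n) := by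
      refine mul_mem_forms (pow_mem_forms_x hm _) ?_ (add_zero _) (zero_add _)
      rw [← map_pow]; exact conj_mem_forms (pow_mem_forms_x hm _)
    have h1 := key (t * (m ^ (4 - i - k) * conj m ^ (4 - j - n))) (mul_mem_forms ht.1 hmem)
    rw [mul_left_comm, ht.2 _ (mul_mem_forms hq hmem)] at h1
    simp only [map_mul, map_pow, evalAt_conj, hma', star_one, one_pow, mul_one] at h1
    exact (mul_eq_zero.1 h1.symm).resolve_right h0

end

/-! ### Edge functionals have small kernels -/

/-- A common zero of all annihilated forms. -/
structure IsBasePoint (L : BiPoly →ₗ[ℂ] ℂ) (z : Fin 2 → ℂ) : Prop where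
  ne_zero : z ≠ 0
  evalAt_eq_zero : ∀ i j, i + j = 4 → j ≤ 2 → ∀ q ∈ annForms L i j, evalAt z q = 0

/-- Nonzero functionals from which no evaluation can be subtracted. -/
structure IsEdge (L : BiPoly →ₗ[ℂ] ℂ) : Prop extends IsPPTFunctional L where
  exists_ne_zero : ∃ p ∈ forms 4 4, L p ≠ 0
  not_isBasePoint : ∀ z, ¬ IsBasePoint L z

lemma isBasePoint_of {L : BiPoly →ₗ[ℂ] ℂ} {z : Fin 2 → ℂ} (hz : z ≠ 0)
    (h40 : ∀ q ∈ annForms L 4 0, evalAt z q = 0) (h31 : ∀ q ∈ annForms L 3 1, evalAt z q = 0)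
    (h22 : ∀ q ∈ annForms L 2 2, evalAt z q = 0) : IsBasePoint L z := by
  refine ⟨hz, fun i j hij hj => ?_⟩
  interval_cases j
  · obtain rfl : i = 4 := by omega
    exact h40
  · obtain rfl : i = 3 := by omega
    exact h31
  · obtain rfl : i = 2 := by omega
    exact h22

namespace IsEdge

variable {L : BiPoly →ₗ[ℂ] ℂ}

/-- The dichotomy for h makes a a zero of the annihilated forms of bidegree (4, 0) and (3, 1), but
does not reach (2, 2). So a linear factor `lin b` of h is conjugated: the dichotomy for conj (lin b)
* g does reach (2, 2), and its other alternative is carried back to h by undoing the conjugation. -/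
lemma lin_mul_mem_four_zero (hL : IsEdge L) {a : Fin 2 → ℂ} (ha : a ≠ 0) {h : BiPoly}
    (hh : h ∈ forms 3 0) (hah : lin a * h ∈ annForms L 4 0) : h ∈ annForms L 3 0 := by
  have hP := hL.toIsPPTFunctional
  have hla := lin_mem_forms a
  obtain ⟨b, hb, hroot⟩ := exists_root hh
  obtain ⟨g, hg, rfl⟩ := exists_eq_lin_mul hb hh (by rw [evalX_of_mem_forms_x hh, hroot, C_0])
  have hlb := lin_mem_forms b
  rcases mem_annForms_or_evalAt_eq_zero (by omega) (by omega) ha hh hah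
    ((hP.mul_mem_annForms_iff (by omega) (by omega) hla hh).1 hah) with h1 | h1
  · exact h1
  have h2 : conj (lin b) * (lin a * g) ∈ annForms L 3 1 :=
    (hP.mul_mem_annForms_iff (i := 3) (j := 0) rfl (by omega) hlb (mul_mem_forms hla hg)).1 (by
      rwa [mul_left_comm])
  have hq : conj (lin b) * g ∈ forms 2 1 := mul_mem_forms (conj_mem_forms hlb) hg
  rw [mul_left_comm] at h2
  rcases mem_annForms_or_evalAt_eq_zero (by omega) (by omega) ha hq h2
    ((hP.mul_mem_annForms_iff (by omega) (by omega) hla hq).1 h2) with h3 | h3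
  · refine mem_annForms_of_xVar_mul (by omega) hh fun k => ?_
    rw [mul_left_comm]
    refine (hP.mul_mem_annForms_iff (i := 3) (j := 0) rfl (by omega) hlb
      (mul_mem_forms (xVar_mem_forms k) hg)).2 ?_
    rw [mul_left_comm]
    exact mul_mem_annForms (xVar_mem_forms k) h3
  · refine absurd (isBasePoint_of ha (fun q hq => ?_) (fun q hq => ?_) (fun q hq => ?_))
      (hL.not_isBasePoint a)
    · have := h1 0 4 (by omega) (by omega) _ (hP.conj_mem_annForms hq)
      rwa [evalAt_conj, star_eq_zero] at this
    · have := h1 1 3 (by omega) (by omega) _ (hP.conj_mem_annForms hq)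
      rwa [evalAt_conj, star_eq_zero] at this
    · exact h3 2 2 (by omega) (by omega) q hq

lemma lin_mul_mem_x (hL : IsEdge L) {i k : ℕ} (hik : i + k = 3) {a : Fin 2 → ℂ} (ha : a ≠ 0)
    {h : BiPoly} (hh : h ∈ forms i 0) (hah : lin a * h ∈ annForms L (i + 1) 0) :
    h ∈ annForms L i 0 := by
  induction k generalizing i h with
  | zero =>
    obtain rfl : i = 3 := hik
    exact hL.lin_mul_mem_four_zero ha hh hah
  | succ k ih =>
    refine mem_annForms_of_xVar_mul (by omega) hh fun n =>
      ih (by omega) (mul_mem_forms (xVar_mem_forms n) hh) ?_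
    rw [mul_left_comm]
    exact mul_mem_annForms (xVar_mem_forms n) hah

/-- Linear factors are cancelled until a constant is left, and an annihilated nonzero constant would
make L vanish on bidegree (4, 4). -/
lemma annForms_x_eq_zero (hL : IsEdge L) {i : ℕ} (hi : i ≤ 4) {f : BiPoly}
    (hf : f ∈ annForms L i 0) : f = 0 := by
  induction i generalizing f with
  | zero =>
    obtain ⟨c, rfl⟩ := exists_eq_C hf.1
    obtain ⟨p, hp, hne⟩ := hL.exists_ne_zero
    have h1 := hf.2 p hp
    rw [map_C_mul] at h1
    rw [(mul_eq_zero.1 h1).resolve_right hne, C_0]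
  | succ i ih =>
    obtain ⟨b, hb, hroot⟩ := exists_root hf.1
    obtain ⟨g, hg, rfl⟩ := exists_eq_lin_mul hb hf.1
      (by rw [evalX_of_mem_forms_x hf.1, hroot, C_0])
    rw [ih (by omega) (hL.lin_mul_mem_x (k := 3 - i) (by omega) hb hg hf), mul_zero]

/-- Here the dichotomy reaches bidegrees up to (2, 3), hence (2, 2) and the conjugates of (3, 1);
bidegree (4, 0) has no nonzero annihilated forms. -/
lemma mem_two_one_of_lin_mul (hL : IsEdge L) {a : Fin 2 → ℂ} (ha : a ≠ 0) {q : BiPoly}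
    (hq : q ∈ forms 2 1) (h : lin a * q ∈ annForms L 3 1) : q ∈ annForms L 2 1 := by
  have hP := hL.toIsPPTFunctional
  rcases mem_annForms_or_evalAt_eq_zero (by omega) (by omega) ha hq h
    ((hP.mul_mem_annForms_iff (by omega) (by omega) (lin_mem_forms a) hq).1 h) with h3 | h3
  · exact h3
  · refine absurd (isBasePoint_of ha (fun q hq => ?_) (fun q hq => ?_) (fun q hq => ?_))
      (hL.not_isBasePoint a)
    · rw [hL.annForms_x_eq_zero (by omega) hq, map_zero]
    · have := h3 1 3 (by omega) (by omega) _ (hP.conj_mem_annForms hq)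
      rwa [evalAt_conj, star_eq_zero] at this
    · exact h3 2 2 (by omega) (by omega) q hq

/-- Conjugating the product and then exchanging conj (lin a) for `lin a` moves the question to
bidegree (3, 1). -/
lemma conj_mem_two_one_of_lin_mul (hL : IsEdge L) {a : Fin 2 → ℂ} (ha : a ≠ 0) {r : BiPoly}
    (hr : r ∈ forms 1 2) (h : lin a * r ∈ annForms L 2 2) : conj r ∈ annForms L 2 1 := by
  refine hL.mem_two_one_of_lin_mul ha (conj_mem_forms hr) ?_
  refine (hL.mul_mem_annForms_iff (i := 2) (j := 1) rfl le_rfl (lin_mem_forms a)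
    (conj_mem_forms hr)).2 ?_
  rw [← map_mul]
  exact hL.conj_mem_annForms h

lemma mem_one_one_of_lin_mul (hL : IsEdge L) {a : Fin 2 → ℂ} (ha : a ≠ 0) {r : BiPoly}
    (hr : r ∈ forms 1 1) (h : lin a * r ∈ annForms L 2 1) : r ∈ annForms L 1 1 := by
  refine mem_annForms_of_xVar_mul (by omega) hr fun k =>
    hL.mem_two_one_of_lin_mul ha (mul_mem_forms (xVar_mem_forms k) hr) ?_
  rw [mul_left_comm]
  exact mul_mem_annForms (xVar_mem_forms k) h

/-- After padding with x₀², the factor r is exchanged for its conjugate; the result has bidegree (4,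
0). -/
lemma eq_zero_of_mul_mem_one_one (hL : IsEdge L) {l r : BiPoly} (hl : l ∈ forms 1 0)
    (hr : r ∈ forms 0 1) (h : l * r ∈ annForms L 1 1) : l * r = 0 := by
  have hx := xVar_mem_forms 0
  have h1 : conj (conj r) * (xVar 0 ^ 2 * l) ∈ annForms L 3 1 := by
    rw [conj_conj, show r * (xVar 0 ^ 2 * l) = xVar 0 ^ 2 * (l * r) by ring]
    exact mul_mem_annForms (pow_mem_forms_x hx 2) h
  have h2 := (hL.mul_mem_annForms_iff (i := 3) (j := 0) rfl (by omega) (conj_mem_forms hr)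
    (mul_mem_forms (pow_mem_forms_x hx 2) hl)).2 h1
  have h3 := hL.annForms_x_eq_zero le_rfl h2
  have hx0 : xVar 0 ≠ 0 := X_ne_zero _
  rcases mul_eq_zero.1 h3 with h4 | h4
  · rw [conj_eq_zero.1 h4, mul_zero]
  · rw [(mul_eq_zero.1 h4).resolve_left (pow_ne_zero 2 hx0), zero_mul]

end IsEdge

lemma C_ne_zero_iff {c : ℂ} : (C c : BiPoly) ≠ 0 ↔ c ≠ 0 := by
  rw [Ne, C_eq_zero]

lemma eq_C_mul_of_add_eq_zero {α β : ℂ} {u v : BiPoly} (hα : α ≠ 0)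
    (h : C α * u + C β * v = 0) : u = C (-β / α) * v := by
  have h1 : (C α : BiPoly) * C (-β / α) = -C β := by
    rw [← C_mul, mul_div_cancel₀ _ hα, C_neg]
  refine mul_left_cancel₀ (C_ne_zero_iff.2 hα) ?_
  linear_combination h - v * h1

lemma C_mul_yVar_add_ne_zero {β γ : ℂ} (h : β ≠ 0 ∨ γ ≠ 0) :
    C β * yVar 0 + C γ * yVar 1 ≠ 0 := by
  intro h0
  have h1 := congrArg (evalAt ![1, 0]) h0
  have h2 := congrArg (evalAt ![0, 1]) h0
  simp at h1 h2
  tauto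

/-- If α were 0, cancelling h would make n divisible by `lin a`, contrary to `hn`. So α is
invertible and u can be solved for. -/
lemma dvd_of_C_mul_add_eq_lin_mul {α : ℂ} {a : Fin 2 → ℂ} {u h n r : BiPoly} (hh : h ≠ 0)
    (e : C α * u + h * n = lin a * r) (hr : h ∣ r) (hn : α = 0 → evalX a n ≠ 0) : h ∣ u := by
  obtain ⟨k, rfl⟩ := hr
  have hα : α ≠ 0 := by
    rintro rfl
    refine hn rfl ?_
    have : n = lin a * k := mul_left_cancel₀ hh (by
      rw [C_0] at e; linear_combination e)
    rw [this, map_mul, evalX_lin, zero_mul]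
  have h1 : (C α⁻¹ : BiPoly) * C α = 1 := by rw [← C_mul, inv_mul_cancel₀ hα, C_1]
  exact ⟨C α⁻¹ * (lin a * k - n), by linear_combination C α⁻¹ * e - u * h1⟩

/-- A Hermitian form of bidegree `(1, 1)` has a zero, or is definite. -/
lemma exists_zero_or_definite {h : BiPoly} (hh : h ∈ forms 1 1) (hconj : conj h = h) :
    (∃ z ≠ 0, evalAt z h = 0) ∨
      ∃ α δ : ℝ, ∃ n ∈ forms 1 0, 0 < δ ∧ C (α : ℂ) * h = n * conj n +
        C (δ : ℂ) * (xVar 1 * yVar 1) := by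
  obtain ⟨r, hr, s, hs, rfl⟩ := exists_eq_xVar hh
  obtain ⟨r0, hr0, r1, hr1, rfl⟩ := exists_eq_yVar hr
  obtain ⟨s0, hs0, s1, hs1, rfl⟩ := exists_eq_yVar hs
  obtain ⟨α, rfl⟩ := exists_eq_C hr0
  obtain ⟨β, rfl⟩ := exists_eq_C hr1
  obtain ⟨β', rfl⟩ := exists_eq_C hs0
  obtain ⟨γ, rfl⟩ := exists_eq_C hs1
  have ev : ∀ z, evalAt z (xVar 0 * (yVar 0 * C α + yVar 1 * C β) +
      xVar 1 * (yVar 0 * C β' + yVar 1 * C γ)) =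
      z 0 * (star (z 0) * α + star (z 1) * β) + z 1 * (star (z 0) * β' + star (z 1) * γ) := by
    intro z; simp
  have hreal : ∀ z : Fin 2 → ℂ, star (z 0 * (star (z 0) * α + star (z 1) * β) +
      z 1 * (star (z 0) * β' + star (z 1) * γ)) =
      z 0 * (star (z 0) * α + star (z 1) * β) + z 1 * (star (z 0) * β' + star (z 1) * γ) := by
    intro z
    rw [← ev, ← evalAt_conj, hconj]
  -- Reality at these four points makes the coefficient matrix Hermitian.
  have h1 := hreal ![1, 0]
  have h2 := hreal ![0, 1]
  have h3 := hreal ![1, 1]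
  have h4 := hreal ![1, Complex.I]
  simp at h1 h2 h3 h4
  obtain ⟨a, rfl⟩ := Complex.conj_eq_iff_real.1 h1
  obtain ⟨c, rfl⟩ := Complex.conj_eq_iff_real.1 h2
  obtain rfl : β' = star β := by
    simp only [Complex.conj_ofReal] at h3 h4
    have e1 : star β + star β' = β + β' := by
      change (starRingEnd ℂ) β + (starRingEnd ℂ) β' = _
      linear_combination h3
    have e2 : star β - star β' = β' - β := by
      change (starRingEnd ℂ) β - (starRingEnd ℂ) β' = _
      have : Complex.I * ((starRingEnd ℂ) β - (starRingEnd ℂ) β') = Complex.I * (β' - β) := by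
        linear_combination h4
      exact mul_left_cancel₀ Complex.I_ne_zero this
    linear_combination (-1/2 : ℂ) * e1 + (-1/2 : ℂ) * e2
  by_cases ha : a = 0
  · refine Or.inl ⟨![1, 0], fun h => by simpa using congrFun h 0, ?_⟩
    rw [ev]; simp [ha]
  have hb : β * star β = (Complex.normSq β : ℂ) := Complex.mul_conj β
  -- The sign of the determinant decides: if it is nonpositive, the quadratic formula at x₁ = 1
  -- gives a zero; otherwise completing the square gives definiteness, with δ the determinant.
  rcases le_or_gt (a * c - Complex.normSq β) 0 with hd | hd
  · refine Or.inl ⟨![(-star β + Real.sqrt (-(a * c - Complex.normSq β))) / a, 1],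
      fun h => by simpa using congrFun h 1, ?_⟩
    have hs : ((Real.sqrt (-(a * c - Complex.normSq β)) : ℝ) : ℂ) ^ 2 =
        -(a * c - β * star β) := by
      rw [← Complex.ofReal_pow, Real.sq_sqrt (by linarith), hb]; push_cast; ring
    rw [ev]
    have ha' : (a : ℂ) ≠ 0 := by exact_mod_cast ha
    simp only [Matrix.cons_val_zero, Matrix.cons_val_one, star_one, star_div₀, star_add, star_neg,
      star_star]
    have r1 : star ((Real.sqrt (-(a * c - Complex.normSq β)) : ℝ) : ℂ) =
      ((Real.sqrt (-(a * c - Complex.normSq β)) : ℝ) : ℂ) := Complex.conj_ofReal _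
    have r2 : star (a : ℂ) = a := Complex.conj_ofReal _
    rw [r1, r2]
    set t := ((Real.sqrt (-(a * c - Complex.normSq β)) : ℝ) : ℂ)
    field_simp
    linear_combination hs
  · refine Or.inr ⟨a, a * c - Complex.normSq β, C (a : ℂ) * xVar 0 + C (star β) * xVar 1,
      Submodule.add_mem _ (C_mul_mem_forms _ (xVar_mem_forms 0))
        (C_mul_mem_forms _ (xVar_mem_forms 1)), hd, ?_⟩
    have hb' : (C β : BiPoly) * C (star β) = C (Complex.normSq β : ℂ) := by rw [← C_mul, hb]
    have r2 : star (a : ℂ) = a := Complex.conj_ofReal _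
    simp only [map_add, map_mul, conj_C, conj_xVar, star_star, r2, Complex.ofReal_sub,
      Complex.ofReal_mul, C_sub]
    linear_combination (-xVar 1 * yVar 1) * hb'

namespace IsEdge

variable {L : BiPoly →ₗ[ℂ] ℂ}

/-- Some combination of g and h splits into linear forms in x and y, hence is zero. -/
lemma eq_C_mul_of_mem_one_one (hL : IsEdge L) {g h : BiPoly} (hg : g ∈ annForms L 1 1)
    (hh : h ∈ annForms L 1 1) (h0 : h ≠ 0) : ∃ c, g = C c * h := by
  obtain ⟨a, ha, m, hm, hma, α, β, hαβ, r, hr, e⟩ :=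
    exists_pencil_eq_lin_mul (i := 0) (d := 1) (e := 0) rfl hg.1 hh.1
  rw [pow_zero, mul_one] at e
  have hmem : lin a * r ∈ annForms L 1 1 := by
    rw [← e]; exact Submodule.add_mem _ (C_mul_mem_annForms _ hg) (C_mul_mem_annForms _ hh)
  rw [hL.eq_zero_of_mul_mem_one_one (lin_mem_forms a) hr hmem] at e
  have hα : α ≠ 0 := by
    rintro rfl
    rw [C_0, zero_mul, zero_add] at e
    exact (mul_ne_zero (C_ne_zero_iff.2 (hαβ.resolve_left fun h => h rfl)) h0) e
  exact ⟨_, eq_C_mul_of_add_eq_zero hα e⟩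

/-- A combination of r and m * h has a linear factor whose cofactor is annihilated of bidegree (1,
1), so is a multiple of h. The next two lemmas repeat this one degree higher. -/
lemma dvd_of_mem_two_one (hL : IsEdge L) {h r : BiPoly} (hh : h ∈ annForms L 1 1) (h0 : h ≠ 0)
    (hr : r ∈ annForms L 2 1) : h ∣ r := by
  obtain ⟨a, ha, m, hm, hma, α, β, hαβ, s, hs, e⟩ :=
    exists_pencil_eq_lin_mul (i := 1) (d := 1) (e := 1) rfl hr.1 hh.1
  have hmem : lin a * s ∈ annForms L 2 1 := by
    rw [← e]
    exact Submodule.add_mem _ (C_mul_mem_annForms _ hr)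
      (mul_mem_annForms (C_mul_mem_forms _ (pow_mem_forms_x hm 1)) hh)
  obtain ⟨c, rfl⟩ := hL.eq_C_mul_of_mem_one_one (hL.mem_one_one_of_lin_mul ha hs hmem) hh h0
  refine dvd_of_C_mul_add_eq_lin_mul (α := α) (n := C β * m ^ 1) h0 (by rw [← e]; ring)
    (dvd_mul_left h (C c)) fun hα => ?_
  simpa [hma] using hαβ.resolve_left fun h => h hα

lemma dvd_of_mem_three_one (hL : IsEdge L) {h u : BiPoly} (hh : h ∈ annForms L 1 1) (h0 : h ≠ 0)
    (hu : u ∈ annForms L 3 1) : h ∣ u := by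
  obtain ⟨a, ha, m, hm, hma, α, β, hαβ, s, hs, e⟩ :=
    exists_pencil_eq_lin_mul (i := 2) (d := 1) (e := 2) rfl hu.1 hh.1
  have hmem : lin a * s ∈ annForms L 3 1 := by
    rw [← e]
    exact Submodule.add_mem _ (C_mul_mem_annForms _ hu)
      (mul_mem_annForms (C_mul_mem_forms _ (pow_mem_forms_x hm 2)) hh)
  refine dvd_of_C_mul_add_eq_lin_mul (α := α) (n := C β * m ^ 2) h0 (by rw [← e]; ring)
    (hL.dvd_of_mem_two_one hh h0 (hL.mem_two_one_of_lin_mul ha hs hmem)) fun hα => ?_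
  simpa [hma] using hαβ.resolve_left fun h => h hα

/-- Degree two in y calls for three forms: w is combined with multiples of y₀ * h and y₁ * h. -/
lemma dvd_of_mem_two_two (hL : IsEdge L) {h w : BiPoly} (hh : h ∈ annForms L 1 1) (h0 : h ≠ 0)
    (hconj : conj h = h) (hw : w ∈ annForms L 2 2) : h ∣ w := by
  have hy : ∀ k, yVar k * h ∈ annForms L 1 2 := fun k => mul_mem_annForms (yVar_mem_forms k) hh
  obtain ⟨a, ha, m, hm, hma, α, β, γ, hαβ, s, hs, e⟩ :=
    exists_net_eq_lin_mul (i := 1) (d := 1) (e := 1) (d' := 1) (e' := 1) rfl rfl hw.1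
      (hy 0).1 (hy 1).1
  have hmem : lin a * s ∈ annForms L 2 2 := by
    rw [← e]
    exact Submodule.add_mem _ (Submodule.add_mem _ (C_mul_mem_annForms _ hw)
      (mul_mem_annForms (C_mul_mem_forms _ (pow_mem_forms_x hm 1)) (hy 0)))
      (mul_mem_annForms (C_mul_mem_forms _ (pow_mem_forms_x hm 1)) (hy 1))
  have hd : h ∣ s := by
    have := map_dvd conj (hL.dvd_of_mem_two_one hh h0 (hL.conj_mem_two_one_of_lin_mul ha hs hmem))
    rwa [hconj, conj_conj] at this
  refine dvd_of_C_mul_add_eq_lin_mul (α := α) (n := m * (C β * yVar 0 + C γ * yVar 1)) h0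
    (by rw [← e]; ring) hd fun hα => ?_
  rw [map_mul, hma, one_mul]
  simpa using C_mul_yVar_add_ne_zero (hαβ.resolve_left fun h => h hα)

/-- All annihilated forms of total degree four are multiples of h, so a zero of h would be a base
point. If h is definite, L (h * |x₁³|²) = 0 is, up to a scalar, a sum of nonnegative terms, which
makes x₁⁴ annihilated. -/
lemma not_conj_eq_self (hL : IsEdge L) {h : BiPoly} (hh : h ∈ annForms L 1 1)
    (hconj : conj h = h) : h = 0 := by
  by_contra h0
  rcases exists_zero_or_definite hh.1 hconj with ⟨z, hz, hev⟩ | ⟨α, δ, n, hn, hδ, e⟩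
  · have hdvd : ∀ q, h ∣ q → evalAt z q = 0 := by
      rintro _ ⟨k, rfl⟩; rw [map_mul, hev, zero_mul]
    exact hL.not_isBasePoint z (isBasePoint_of hz
      (fun q hq => by rw [hL.annForms_x_eq_zero le_rfl hq, map_zero])
      (fun q hq => hdvd q (hL.dvd_of_mem_three_one hh h0 hq))
      (fun q hq => hdvd q (hL.dvd_of_mem_two_two hh h0 hconj hq)))
  · have hx := pow_mem_forms_x (xVar_mem_forms 1) 3
    have h1 : L (C (α : ℂ) * h * (xVar 1 ^ 3 * conj (xVar 1 ^ 3))) = 0 := by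
      rw [mul_assoc, map_C_mul, hh.2 _ (mul_mem_forms hx (conj_mem_forms hx)), mul_zero]
    have h2 : C (α : ℂ) * h * (xVar 1 ^ 3 * conj (xVar 1 ^ 3)) =
        n * xVar 1 ^ 3 * conj (n * xVar 1 ^ 3) +
          C (δ : ℂ) * (xVar 1 ^ 4 * conj (xVar 1 ^ 4)) := by
      rw [e]; simp only [map_mul, map_pow, conj_xVar]; ring
    rw [h2, map_add, map_C_mul] at h1
    have h3 := congrArg Complex.re h1
    rw [Complex.add_re, Complex.re_ofReal_mul, Complex.zero_re] at h3
    have hx4 := pow_mem_forms_x (xVar_mem_forms 1) 4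
    have h4 := hL.nonneg 4 0 rfl (by omega) _ (mul_mem_forms hn hx)
    have h5 := hL.nonneg 4 0 rfl (by omega) _ hx4
    have h6 : (L (xVar 1 ^ 4 * conj (xVar 1 ^ 4))).re = 0 := by nlinarith
    have h7 := hL.annForms_x_eq_zero le_rfl
      (hL.mem_annForms_of_map_mul_conj (i := 4) (j := 0) rfl (by omega) hx4 h6)
    exact pow_ne_zero 4 (X_ne_zero _ : xVar 1 ≠ 0) h7

lemma annForms_one_one_eq_zero (hL : IsEdge L) {h : BiPoly} (hh : h ∈ annForms L 1 1) :
    h = 0 := by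
  have hc := hL.conj_mem_annForms hh
  have h1 := hL.not_conj_eq_self (Submodule.add_mem _ hh hc) (by
    rw [map_add, conj_conj, add_comm])
  have h2 := hL.not_conj_eq_self (C_mul_mem_annForms Complex.I (Submodule.sub_mem _ hh hc)) (by
    rw [map_mul, map_sub, conj_conj, conj_C]
    have : star Complex.I = -Complex.I := Complex.conj_I
    rw [this, C_neg]; ring)
  have h3 := (mul_eq_zero.1 h2).resolve_left (C_ne_zero_iff.2 Complex.I_ne_zero)
  have h4 : C 2 * h = 0 := by
    have : (C 2 : BiPoly) = 2 := map_ofNat C 2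
    rw [this]; linear_combination h1 + h3
  exact (mul_eq_zero.1 h4).resolve_left (C_ne_zero_iff.2 two_ne_zero)

lemma eq_zero_of_lin_mul_mem_two_one (hL : IsEdge L) {a : Fin 2 → ℂ} (ha : a ≠ 0) {r : BiPoly}
    (hr : r ∈ forms 1 1) (h : lin a * r ∈ annForms L 2 1) : r = 0 :=
  hL.annForms_one_one_eq_zero (hL.mem_one_one_of_lin_mul ha hr h)

lemma eq_C_mul_of_mem_two_one (hL : IsEdge L) {g h : BiPoly} (hg : g ∈ annForms L 2 1)
    (hh : h ∈ annForms L 2 1) (h0 : h ≠ 0) : ∃ c, g = C c * h := by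
  obtain ⟨a, ha, m, hm, hma, α, β, hαβ, r, hr, e⟩ :=
    exists_pencil_eq_lin_mul (i := 1) (d := 2) (e := 0) rfl hg.1 hh.1
  rw [pow_zero, mul_one] at e
  have hmem : lin a * r ∈ annForms L 2 1 := by
    rw [← e]; exact Submodule.add_mem _ (C_mul_mem_annForms _ hg) (C_mul_mem_annForms _ hh)
  rw [hL.eq_zero_of_lin_mul_mem_two_one ha hr hmem, mul_zero] at e
  have hα : α ≠ 0 := by
    rintro rfl
    rw [C_0, zero_mul, zero_add] at e
    exact (mul_ne_zero (C_ne_zero_iff.2 (hαβ.resolve_left fun h => h rfl)) h0) e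
  exact ⟨_, eq_C_mul_of_add_eq_zero hα e⟩

/-- Combining y₀ * q, y₁ * q and m * conj q, and using that such q is unique up to scalars, gives q
* (form in y) = (form in x) * conj q with both forms linear. This forces a linear factor in x on q,
whose cofactor of bidegree (1, 1) is zero. -/
lemma annForms_two_one_eq_zero (hL : IsEdge L) {q : BiPoly} (hq : q ∈ annForms L 2 1) :
    q = 0 := by
  by_contra h0
  have hy : ∀ k, yVar k * q ∈ annForms L 2 2 := fun k => mul_mem_annForms (yVar_mem_forms k) hq
  have hc := hL.conj_mem_annForms hq
  have hc0 : conj q ≠ 0 := fun h => h0 (conj_eq_zero.1 h)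
  obtain ⟨a, ha, m, hm, hma, α, β, γ, hαβ, s, hs, e⟩ :=
    exists_net_eq_lin_mul (i := 1) (d := 2) (e := 0) (d' := 1) (e' := 1) rfl rfl (hy 0).1
      (hy 1).1 hc.1
  have hmem : lin a * s ∈ annForms L 2 2 := by
    rw [← e, pow_zero, mul_one]
    exact Submodule.add_mem _ (Submodule.add_mem _ (C_mul_mem_annForms _ (hy 0))
      (C_mul_mem_annForms _ (hy 1)))
      (mul_mem_annForms (C_mul_mem_forms _ (pow_mem_forms_x hm 1)) hc)
  obtain ⟨c, hcs⟩ := hL.eq_C_mul_of_mem_two_one (hL.conj_mem_two_one_of_lin_mul ha hs hmem) hq h0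
  have hs' : s = C (star c) * conj q := by
    rw [← conj_conj s, hcs, map_mul, conj_C]
  have e1 : q * (C α * yVar 0 + C β * yVar 1) = (C (star c) * lin a - C γ * m) * conj q := by
    rw [hs'] at e; linear_combination e
  -- Otherwise the linear form in x on the right of `e1` is zero, and its value at a gives γ = 0.
  have hαβ' : α ≠ 0 ∨ β ≠ 0 := by
    by_contra! h
    obtain ⟨rfl, rfl⟩ := h
    have hγ : γ ≠ 0 := by tauto
    rw [C_0, zero_mul, zero_mul, add_zero, mul_zero] at e1
    have e2 := (mul_eq_zero.1 e1.symm).resolve_right hc0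
    have e3 := congrArg (evalX a) e2
    simp [hma] at e3
    exact hγ e3
  have hne := C_mul_yVar_add_ne_zero hαβ'
  have hn : C (star c) * lin a - C γ * m ∈ forms 1 0 :=
    Submodule.sub_mem _ (C_mul_mem_forms _ (lin_mem_forms a)) (C_mul_mem_forms _ hm)
  obtain ⟨b, hb, hroot⟩ := exists_root hn
  have e4 := congrArg (evalX b) e1
  rw [map_mul, map_mul, evalX_of_mem_forms_x hn, hroot, C_0, zero_mul] at e4
  have e5 : evalX b q = 0 := (mul_eq_zero.1 e4).resolve_right (by simpa using hne)
  obtain ⟨r, hr, rfl⟩ := exists_eq_lin_mul hb hq.1 e5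
  exact h0 (by rw [hL.eq_zero_of_lin_mul_mem_two_one hb hr hq, mul_zero])

/-- The cofactor of the combination with a linear factor is annihilated of bidegree (2, 1), so it
vanishes; the next lemma uses the same argument after conjugation. -/
lemma three_one_dependent (hL : IsEdge L) {u v : BiPoly} (hu : u ∈ annForms L 3 1)
    (hv : v ∈ annForms L 3 1) : ∃ α β : ℂ, (α ≠ 0 ∨ β ≠ 0) ∧ C α * u + C β * v = 0 := by
  obtain ⟨a, ha, m, hm, hma, α, β, hαβ, r, hr, e⟩ :=
    exists_pencil_eq_lin_mul (i := 2) (d := 3) (e := 0) rfl hu.1 hv.1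
  rw [pow_zero, mul_one] at e
  refine ⟨α, β, hαβ, ?_⟩
  have hmem : lin a * r ∈ annForms L 3 1 := by
    rw [← e]; exact Submodule.add_mem _ (C_mul_mem_annForms _ hu) (C_mul_mem_annForms _ hv)
  rw [e, hL.annForms_two_one_eq_zero (hL.mem_two_one_of_lin_mul ha hr hmem), mul_zero]

lemma two_two_dependent (hL : IsEdge L) {u v w : BiPoly} (hu : u ∈ annForms L 2 2)
    (hv : v ∈ annForms L 2 2) (hw : w ∈ annForms L 2 2) :
    ∃ α β γ : ℂ, (α ≠ 0 ∨ β ≠ 0 ∨ γ ≠ 0) ∧ C α * u + C β * v + C γ * w = 0 := by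
  obtain ⟨a, ha, m, hm, hma, α, β, γ, hαβ, r, hr, e⟩ :=
    exists_net_eq_lin_mul (i := 1) (d := 2) (e := 0) (d' := 2) (e' := 0) rfl rfl hu.1 hv.1 hw.1
  rw [pow_zero, mul_one, mul_one] at e
  refine ⟨α, β, γ, hαβ, ?_⟩
  have hmem : lin a * r ∈ annForms L 2 2 := by
    rw [← e]
    exact Submodule.add_mem _ (Submodule.add_mem _ (C_mul_mem_annForms _ hu)
      (C_mul_mem_annForms _ hv)) (C_mul_mem_annForms _ hw)
  rw [e, conj_eq_zero.1 (hL.annForms_two_one_eq_zero (hL.conj_mem_two_one_of_lin_mul ha hr hmem)),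
    mul_zero]

end IsEdge

/-! ### Subtracting evaluations -/

section

variable {L : BiPoly →ₗ[ℂ] ℂ}

lemma annForms_le_forms (i j : ℕ) : annForms L i j ≤ forms i j := fun _ h => h.1

instance (i j : ℕ) : FiniteDimensional ℂ (annForms L i j) :=
  Submodule.finiteDimensional_of_le (annForms_le_forms i j)

lemma exists_evalAt_ne_zero {z : Fin 2 → ℂ} (hz : z ≠ 0) (i j : ℕ) :
    ∃ q ∈ forms i j, evalAt z q ≠ 0 := by
  obtain ⟨m, hm, hmz, -⟩ := exists_complement hz
  have hmz_at : evalAt z m = 1 := by rw [← evalAt_evalX, hmz, map_one]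
  refine ⟨m ^ i * conj (m ^ j), mul_mem_forms (pow_mem_forms_x hm i)
    (conj_mem_forms (pow_mem_forms_x hm j)), ?_⟩
  simp [evalAt_conj, hmz_at]

/-- A linear functional vanishing on the annihilated forms is represented by a form. -/
lemma exists_representative {i j : ℕ} (hij : i + j = 4) (φ : BiPoly →ₗ[ℂ] ℂ)
    (h : ∀ q ∈ annForms L i j, φ q = 0) :
    ∃ p ∈ forms j i, ∀ q ∈ forms i j, L (q * p) = φ q := by
  let B : forms i j →ₗ[ℂ] Module.Dual ℂ (forms j i) :=
    LinearMap.mk₂ ℂ (fun q p => L (q.1 * p.1)) (fun q q' p => by simp [add_mul])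
      (fun c q p => by simp) (fun q p p' => by simp [mul_add]) (fun c q p => by simp)
  -- φ vanishes on the kernel of the pairing, so it factors through the dual of `forms j i`, where
  -- reflexivity supplies p.
  have hB : φ.comp (forms i j).subtype ∈ LinearMap.range B.dualMap := by
    rw [LinearMap.range_dualMap_eq_dualAnnihilator_ker, Submodule.mem_dualAnnihilator]
    intro q hq
    refine h q.1 ⟨q.2, fun p hp => ?_⟩
    rw [show 4 - i = j by omega, show 4 - j = i by omega] at hp
    exact LinearMap.congr_fun (LinearMap.mem_ker.1 hq) ⟨p, hp⟩
  obtain ⟨ψ, hψ⟩ := hB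
  obtain ⟨p, rfl⟩ := (Module.evalEquiv ℂ (forms j i)).surjective ψ
  exact ⟨p.1, p.2, fun q hq => LinearMap.congr_fun hψ ⟨q, hq⟩⟩

/-- At a base point, evaluation vanishes on the kernel, so it is q ↦ L (q * conj u) for some u. The
bound is Cauchy–Schwarz, with μ = L (u * conj u) = u(z). -/
lemma IsPPTFunctional.exists_evalAt_bound (hL : IsPPTFunctional L) {z : Fin 2 → ℂ}
    (hz : IsBasePoint L z) {i j : ℕ} (hij : i + j = 4) (hj : j ≤ 2) :
    ∃ μ : ℝ, 0 < μ ∧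
      (∀ q ∈ forms i j, Complex.normSq (evalAt z q) ≤ μ * (L (q * conj q)).re) ∧
      ∃ u ∈ forms i j, evalAt z u = μ ∧ ∀ p ∈ forms j i, L (u * p) = evalAt z p := by
  obtain ⟨p, hp, hrep⟩ := exists_representative (L := L) hij (evalAt z).toLinearMap
    (fun q hq => hz.evalAt_eq_zero i j hij hj q hq)
  have hu := conj_mem_forms hp
  obtain ⟨u, rfl⟩ : ∃ u, p = conj u := ⟨conj p, (conj_conj p).symm⟩
  rw [conj_conj] at hu
  replace hrep : ∀ q ∈ forms i j, L (q * conj u) = evalAt z q := hrep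
  have hrep' : ∀ p ∈ forms j i, L (u * p) = evalAt z p := by
    intro p hp
    have h1 := hrep _ (conj_mem_forms hp)
    rw [← map_mul, hL.map_conj, evalAt_conj, mul_comm] at h1
    exact star_injective h1
  have hreal : evalAt z u = ((L (u * conj u)).re : ℂ) := by
    have h1 := hL.map_conj (u * conj u)
    rw [map_mul conj, conj_conj, mul_comm] at h1
    rw [← hrep u hu]
    exact (Complex.conj_eq_iff_re.1 h1.symm).symm
  have hpos : 0 < (L (u * conj u)).re := by
    refine lt_of_le_of_ne (hL.nonneg i j hij hj u hu) fun h => ?_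
    have hann := hL.mem_annForms_of_map_mul_conj hij hj hu h.symm
    obtain ⟨q, hq, hne⟩ := exists_evalAt_ne_zero hz.ne_zero j i
    refine hne ?_
    rw [← hrep' q hq]
    exact hann.2 q (by rwa [show 4 - i = j by omega, show 4 - j = i by omega])
  refine ⟨_, hpos, fun q hq => ?_, u, hu, hreal, hrep'⟩
  set μ := (L (u * conj u)).re
  have hmul : evalAt z q * star (evalAt z q) = (Complex.normSq (evalAt z q) : ℂ) :=
    Complex.mul_conj _
  have h2 : L (u * conj q) = star (evalAt z q) := by
    rw [hrep' _ (conj_mem_forms hq), evalAt_conj]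
  -- The multiple of u that minimizes the square.
  have h1 := hL.nonneg i j hij hj (q + C (-(evalAt z q) / μ) * u)
    (Submodule.add_mem _ hq (C_mul_mem_forms _ hu))
  rw [hL.re_map_add, h2] at h1
  have h3 : -(evalAt z q) / μ * star (evalAt z q) =
      ((-(Complex.normSq (evalAt z q)) / μ : ℝ) : ℂ) := by
    push_cast; rw [← hmul]; ring
  have h4 : Complex.normSq (-(evalAt z q) / (μ : ℂ)) = Complex.normSq (evalAt z q) / μ ^ 2 := by
    rw [map_div₀, Complex.normSq_neg, Complex.normSq_ofReal, sq]
  rw [h3, h4, Complex.ofReal_re] at h1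
  have h5 : Complex.normSq (evalAt z q) / μ ^ 2 * μ = Complex.normSq (evalAt z q) / μ := by
    field_simp
  rw [show (L (u * conj u)).re = μ from rfl, h5] at h1
  have h6 : Complex.normSq (evalAt z q) / μ ≤ (L (q * conj q)).re := by
    have : 2 * (-Complex.normSq (evalAt z q) / μ) = -2 * (Complex.normSq (evalAt z q) / μ) := by
      ring
    linarith
  rw [div_le_iff₀ hpos] at h6
  linarith

/-- The functional `L` minus `c` times the evaluation at `z`. -/
noncomputable def subEval (L : BiPoly →ₗ[ℂ] ℂ) (c : ℝ) (z : Fin 2 → ℂ) : BiPoly →ₗ[ℂ] ℂ :=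
  L - (c : ℂ) • (evalAt z).toLinearMap

lemma subEval_apply (L : BiPoly →ₗ[ℂ] ℂ) (c : ℝ) (z : Fin 2 → ℂ) (p : BiPoly) :
    subEval L c z p = L p - c * evalAt z p := rfl

lemma isPPTFunctional_subEval (hL : IsPPTFunctional L) {c : ℝ} {z : Fin 2 → ℂ}
    (h : ∀ i j, i + j = 4 → j ≤ 2 → ∀ q ∈ forms i j,
      c * Complex.normSq (evalAt z q) ≤ (L (q * conj q)).re) :
    IsPPTFunctional (subEval L c z) := by
  refine ⟨fun p => ?_, fun i j hij hj q hq => ?_⟩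
  · have : star (c : ℂ) = c := Complex.conj_ofReal c
    rw [subEval_apply, subEval_apply, hL.map_conj, evalAt_conj, star_sub, star_mul, this, mul_comm]
  · have hmul : evalAt z q * star (evalAt z q) = (Complex.normSq (evalAt z q) : ℂ) :=
      Complex.mul_conj _
    rw [subEval_apply, map_mul (evalAt z), evalAt_conj, hmul, Complex.sub_re, Complex.re_ofReal_mul,
      Complex.ofReal_re]
    exact sub_nonneg.2 (h i j hij hj q hq)

lemma annForms_le_subEval {z : Fin 2 → ℂ} (hz : IsBasePoint L z) (c : ℝ) {i j : ℕ}
    (hij : i + j = 4) (hj : j ≤ 2) : annForms L i j ≤ annForms (subEval L c z) i j := by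
  refine fun q hq => ⟨hq.1, fun p hp => ?_⟩
  rw [subEval_apply, hq.2 p hp, map_mul, hz.evalAt_eq_zero i j hij hj q hq]
  ring

/-- The total dimension of the annihilated forms of total degree four. -/
noncomputable def nullity (L : BiPoly →ₗ[ℂ] ℂ) : ℕ :=
  ∑ j ∈ Finset.range 3, Module.finrank ℂ (annForms L (4 - j) j)

/-- The reciprocal of the largest of the three constants μ keeps all three forms nonnegative. In the
extremal bidegree the representing form u becomes annihilated; it was not before, since u(z) = μ ≠
0. -/
lemma IsPPTFunctional.exists_subEval (hL : IsPPTFunctional L) {z : Fin 2 → ℂ}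
    (hz : IsBasePoint L z) :
    ∃ c : ℝ, 0 ≤ c ∧ IsPPTFunctional (subEval L c z) ∧ nullity L < nullity (subEval L c z) := by
  have hj4 : ∀ j ∈ Finset.range 3, 4 - j + j = 4 := fun j hj => by
    have := Finset.mem_range.1 hj; omega
  have hj2 : ∀ j ∈ Finset.range 3, j ≤ 2 := fun j hj => by
    have := Finset.mem_range.1 hj; omega
  have H : ∀ j : ℕ, ∃ μ : ℝ, j ∈ Finset.range 3 → 0 < μ ∧
      (∀ q ∈ forms (4 - j) j, Complex.normSq (evalAt z q) ≤ μ * (L (q * conj q)).re) ∧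
      ∃ u ∈ forms (4 - j) j, evalAt z u = μ ∧
        ∀ p ∈ forms j (4 - j), L (u * p) = evalAt z p := by
    intro j
    by_cases hj : j ∈ Finset.range 3
    · obtain ⟨μ, h⟩ := hL.exists_evalAt_bound hz (hj4 j hj) (hj2 j hj)
      exact ⟨μ, fun _ => h⟩
    · exact ⟨0, fun h => absurd h hj⟩
  choose μ hμ using H
  obtain ⟨k, hk, hmax⟩ := Finset.exists_max_image (Finset.range 3) μ ⟨0, by simp⟩
  obtain ⟨hpos, -, u, hu, huz, hrep⟩ := hμ k hk
  refine ⟨(μ k)⁻¹, inv_nonneg.2 hpos.le, isPPTFunctional_subEval hL fun i j hij hj q hq => ?_,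
    Finset.sum_lt_sum (fun j hj => Submodule.finrank_mono
      (annForms_le_subEval hz _ (hj4 j hj) (hj2 j hj))) ⟨k, hk, ?_⟩⟩
  · have hj' : j ∈ Finset.range 3 := Finset.mem_range.2 (by omega)
    obtain rfl : i = 4 - j := by omega
    have h1 := (hμ j hj').2.1 q hq
    have h2 : μ j * (L (q * conj q)).re ≤ μ k * (L (q * conj q)).re :=
      mul_le_mul_of_nonneg_right (hmax j hj') (hL.nonneg _ _ hij hj q hq)
    rw [inv_mul_le_iff₀ hpos]
    exact h1.trans h2
  · refine Submodule.finrank_lt_finrank_of_lt (lt_of_le_of_ne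
      (annForms_le_subEval hz _ (hj4 k hk) (hj2 k hk)) fun heq => ?_)
    have hmem : u ∈ annForms (subEval L (μ k)⁻¹ z) (4 - k) k := by
      refine ⟨hu, fun p hp => ?_⟩
      rw [show 4 - (4 - k) = k by have := hj2 k hk; omega] at hp
      have : (μ k : ℂ) ≠ 0 := by exact_mod_cast hpos.ne'
      rw [subEval_apply, hrep p hp, map_mul, huz]
      push_cast
      field_simp
      ring
    rw [← heq] at hmem
    have h0 := hz.evalAt_eq_zero _ _ (hj4 k hk) (hj2 k hk) u hmem
    rw [huz] at h0
    exact hpos.ne' (by exact_mod_cast h0)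

lemma nullity_le (L : BiPoly →ₗ[ℂ] ℂ) :
    nullity L ≤ ∑ j ∈ Finset.range 3, Module.finrank ℂ (forms (4 - j) j) :=
  Finset.sum_le_sum fun _ _ => Submodule.finrank_mono (annForms_le_forms _ _)

/-- The functional is degenerate enough to be a combination of evaluations. -/
def IsDegenerate (L : BiPoly →ₗ[ℂ] ℂ) : Prop :=
  1 ≤ Module.finrank ℂ (annForms L 4 0) ∨ 2 ≤ Module.finrank ℂ (annForms L 3 1) ∨
    3 ≤ Module.finrank ℂ (annForms L 2 2)

lemma IsDegenerate.subEval (h : IsDegenerate L) {z : Fin 2 → ℂ} (hz : IsBasePoint L z) (c : ℝ) :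
    IsDegenerate (subEval L c z) := by
  rcases h with h | h | h
  · exact Or.inl (h.trans (Submodule.finrank_mono (annForms_le_subEval hz c rfl (by omega))))
  · exact Or.inr (Or.inl (h.trans
      (Submodule.finrank_mono (annForms_le_subEval hz c rfl (by omega)))))
  · exact Or.inr (Or.inr (h.trans
      (Submodule.finrank_mono (annForms_le_subEval hz c rfl (by omega)))))

lemma IsEdge.not_isDegenerate (hL : IsEdge L) : ¬ IsDegenerate L := by
  rintro (h | h | h)
  · obtain ⟨f, hf⟩ := exists_linearIndependent_of_le_finrank h
    exact hf.ne_zero 0 (Subtype.ext (hL.annForms_x_eq_zero le_rfl (f 0).2))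
  · obtain ⟨f, hf⟩ := exists_linearIndependent_of_le_finrank h
    obtain ⟨α, β, hne, e⟩ := hL.three_one_dependent (f 0).2 (f 1).2
    have h1 := Fintype.linearIndependent_iff.1 hf ![α, β] (Subtype.ext (by
      simpa [Fin.sum_univ_two, smul_eq_C_mul] using e))
    have h2 := h1 0
    have h3 := h1 1
    simp at h2 h3
    tauto
  · obtain ⟨f, hf⟩ := exists_linearIndependent_of_le_finrank h
    obtain ⟨α, β, γ, hne, e⟩ := hL.two_two_dependent (f 0).2 (f 1).2 (f 2).2
    have h1 := Fintype.linearIndependent_iff.1 hf ![α, β, γ] (Subtype.ext (by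
      simpa [Fin.sum_univ_three, smul_eq_C_mul] using e))
    have h2 := h1 0
    have h3 := h1 1
    have h4 := h1 2
    simp at h2 h3 h4
    tauto

/-- A degenerate PPT functional is a nonnegative combination of evaluations. -/
theorem IsPPTFunctional.exists_eq_sum_evalAt (hL : IsPPTFunctional L) (hd : IsDegenerate L) :
    ∃ (n : ℕ) (c : Fin n → ℝ) (z : Fin n → Fin 2 → ℂ), (∀ k, 0 ≤ c k) ∧ (∀ k, z k ≠ 0) ∧
      ∀ p ∈ forms 4 4, L p = ∑ k, (c k : ℂ) * evalAt (z k) p := by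
  -- The nullity is bounded and grows with each subtraction, so the gap to the bound is the
  -- induction variable.
  induction hN : (∑ j ∈ Finset.range 3, Module.finrank ℂ (forms (4 - j) j)) - nullity L
    using Nat.strong_induction_on generalizing L with
  | _ N ih =>
    by_cases h0 : ∀ p ∈ forms 4 4, L p = 0
    · exact ⟨0, Fin.elim0, Fin.elim0, fun k => k.elim0, fun k => k.elim0, fun p hp => by
        simpa using h0 p hp⟩
    push Not at h0
    by_cases hz : ∃ z, IsBasePoint L z
    · obtain ⟨z, hz⟩ := hz
      obtain ⟨c, hc, hP, hlt⟩ := hL.exists_subEval hz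
      have hle := nullity_le (subEval L c z)
      obtain ⟨n, c', z', hc', hz', e⟩ := ih _ (by omega) hP (hd.subEval hz c) rfl
      refine ⟨n + 1, Fin.cons c c', Fin.cons z z', fun k => ?_, fun k => ?_, fun p hp => ?_⟩
      · refine Fin.cases ?_ (fun k => ?_) k
        exacts [hc, hc' k]
      · refine Fin.cases ?_ (fun k => ?_) k
        exacts [hz.ne_zero, hz' k]
      · have := e p hp
        rw [subEval_apply] at this
        rw [Fin.sum_univ_succ]
        simp only [Fin.cons_zero, Fin.cons_succ]
        rw [← this]; ring
    · push Not at hz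
      exact absurd hd (IsEdge.not_isDegenerate ⟨hL, h0, hz⟩)

end

/-! ### From symmetric states to functionals -/

open scoped ComplexOrder

/-- The bit string whose first `k` bits are `1`. -/
def sortedString (k : ℕ) : Fin 4 → Fin 2 := fun j => if j.val < k then 1 else 0

lemma exists_perm_eq_sortedString :
    ∀ s : Fin 4 → Fin 2, ∃ π : Equiv.Perm (Fin 4), s ∘ π = sortedString (∑ j, (s j : ℕ)) := by
  decide

/-- The functional with `L (∏ x_{s j} * ∏ y_{t j}) = ρ s t` attached to a symmetric `ρ`. -/
noncomputable def momentFunctional (ρ : Op 4) : BiPoly →ₗ[ℂ] ℂ :=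
  -- The exponents of x₁ and y₁ count the ones in s and t. Outside bidegree (4, 4) the values are
  -- arbitrary, only Hermitian.
  (basisMonomials (Fin 2 ⊕ Fin 2) ℂ).constr ℂ fun d =>
    ρ (sortedString (d (Sum.inl 1))) (sortedString (d (Sum.inr 1)))

lemma momentFunctional_monomial (ρ : Op 4) (d : Fin 2 ⊕ Fin 2 →₀ ℕ) (c : ℂ) :
    momentFunctional ρ (monomial d c) =
      c * ρ (sortedString (d (Sum.inl 1))) (sortedString (d (Sum.inr 1))) := by
  have h : (monomial d c : BiPoly) = c • basisMonomials (Fin 2 ⊕ Fin 2) ℂ d := by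
    simp [coe_basisMonomials, smul_monomial]
  rw [h, map_smul, momentFunctional, Module.Basis.constr_basis, smul_eq_mul]

lemma momentFunctional_conj {ρ : Op 4} (hρ : ρ.IsHermitian) (p : BiPoly) :
    momentFunctional ρ (conj p) = star (momentFunctional ρ p) := by
  induction p using MvPolynomial.induction_on' with
  | monomial d c =>
    have h1 : conj (monomial d c) = monomial (d.mapDomain Sum.swap) (star c) := by
      simp [conj, map_monomial, rename_monomial]
    have hinj : Function.Injective (Sum.swap : Fin 2 ⊕ Fin 2 → Fin 2 ⊕ Fin 2) :=
      Sum.swap_leftInverse.injective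
    have h2 : d.mapDomain Sum.swap (Sum.inl 1) = d (Sum.inr 1) :=
      Finsupp.mapDomain_apply hinj d (Sum.inr 1)
    have h3 : d.mapDomain Sum.swap (Sum.inr 1) = d (Sum.inl 1) :=
      Finsupp.mapDomain_apply hinj d (Sum.inl 1)
    rw [h1, momentFunctional_monomial, momentFunctional_monomial, h2, h3, star_mul', hρ.apply]
  | add p q hp hq => rw [map_add, map_add, hp, hq, map_add, star_add]

lemma apply_comp_perm {ρ : Op 4} (hsym : IsSymmetric ρ) (π : Equiv.Perm (Fin 4))
    (s t : Fin 4 → Fin 2) : ρ (s ∘ π) t = ρ s t := by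
  have h1 : ρ.mulVecLin (Pi.single t 1) ∈ symmetricSubspace 4 := hsym ⟨_, rfl⟩
  have h2 := h1 π s
  simpa using h2

lemma apply_sortedString {ρ : Op 4} (hρ : ρ.IsHermitian) (hsym : IsSymmetric ρ)
    (s t : Fin 4 → Fin 2) :
    ρ (sortedString (∑ j, (s j : ℕ))) (sortedString (∑ j, (t j : ℕ))) = ρ s t := by
  obtain ⟨π, hπ⟩ := exists_perm_eq_sortedString s
  obtain ⟨τ, hτ⟩ := exists_perm_eq_sortedString t
  rw [← hπ, ← hτ, apply_comp_perm hsym, ← hρ.apply, apply_comp_perm hsym, hρ.apply]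

lemma momentFunctional_prod {ρ : Op 4} (hρ : ρ.IsHermitian) (hsym : IsSymmetric ρ)
    (s t : Fin 4 → Fin 2) :
    momentFunctional ρ ((∏ j, xVar (s j)) * ∏ j, yVar (t j)) = ρ s t := by
  have h1 : (∏ j, xVar (s j)) * ∏ j, yVar (t j) = monomial
      (∑ j, Finsupp.single (Sum.inl (s j)) 1 + ∑ j, Finsupp.single (Sum.inr (t j)) 1) 1 := by
    rw [← one_mul (1 : ℂ), ← monomial_mul, monomial_sum_one, monomial_sum_one]
    rfl
  have h2 : ∀ k : Fin 2, (if k = 1 then 1 else 0) = (k : ℕ) := by decide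
  rw [h1, momentFunctional_monomial, one_mul]
  simp only [Finsupp.add_apply, Finsupp.finsetSum_apply, Finsupp.single_apply, Sum.inl.injEq,
    Sum.inr.injEq, reduceCtorEq, if_false, Finset.sum_const_zero, add_zero, zero_add, h2]
  exact apply_sortedString hρ hsym s t

/-- The monomial of a bit string, with antiholomorphic variables at the positions in `S`. -/
noncomputable def stringMonomial (S : Finset (Fin 4)) (x : Fin 4 → Fin 2) : BiPoly :=
  ∏ j, if j ∈ S then yVar (x j) else xVar (x j)

/-- The form with given coefficients on the monomials of bit strings. -/
noncomputable def toForm (S : Finset (Fin 4)) : ((Fin 4 → Fin 2) → ℂ) →ₗ[ℂ] BiPoly :=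
  Fintype.linearCombination ℂ (stringMonomial S)

lemma toForm_apply (S : Finset (Fin 4)) (v : (Fin 4 → Fin 2) → ℂ) :
    toForm S v = ∑ x, v x • stringMonomial S x := rfl

/-- At a position in S, x and y trade places in both factors, which is exactly the exchange of row
and column bits. -/
lemma momentFunctional_stringMonomial {ρ : Op 4} (hρ : ρ.IsHermitian) (hsym : IsSymmetric ρ)
    (S : Finset (Fin 4)) (x y : Fin 4 → Fin 2) :
    momentFunctional ρ (stringMonomial S x * conj (stringMonomial S y)) =
      partialTranspose S ρ x y := by
  have h : stringMonomial S x * conj (stringMonomial S y) =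
      (∏ j, xVar (S.piecewise y x j)) * ∏ j, yVar (S.piecewise x y j) := by
    rw [stringMonomial, stringMonomial, map_prod, ← Finset.prod_mul_distrib,
      ← Finset.prod_mul_distrib]
    refine Finset.prod_congr rfl fun j _ => ?_
    by_cases hj : j ∈ S
    · simp [hj, mul_comm]
    · simp [hj]
  rw [h, momentFunctional_prod hρ hsym, partialTranspose, Matrix.of_apply]

lemma conj_smul (c : ℂ) (p : BiPoly) : conj (c • p) = star c • conj p := by
  rw [smul_eq_C_mul, map_mul, conj_C, smul_eq_C_mul]

lemma momentFunctional_toForm {ρ : Op 4} (hρ : ρ.IsHermitian) (hsym : IsSymmetric ρ)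
    (S : Finset (Fin 4)) (v w : (Fin 4 → Fin 2) → ℂ) :
    momentFunctional ρ (toForm S v * conj (toForm S w)) =
      dotProduct v ((partialTranspose S ρ).mulVec (star w)) := by
  rw [toForm_apply, toForm_apply, map_sum conj, Finset.sum_mul_sum]
  simp only [map_sum, conj_smul, smul_mul_smul_comm, map_smul,
    momentFunctional_stringMonomial hρ hsym, dotProduct, Matrix.mulVec, Finset.mul_sum,
    smul_eq_mul, Pi.star_apply]
  refine Finset.sum_congr rfl fun x _ => Finset.sum_congr rfl fun y _ => by ring

lemma mul_forms_succ_x_mem {N : Submodule ℂ BiPoly} {i j : ℕ} {p : BiPoly}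
    (h : ∀ k, ∀ r ∈ forms i j, p * xVar k * r ∈ N) : ∀ r ∈ forms (i + 1) j, p * r ∈ N := by
  intro r hr
  obtain ⟨s, hs, t, ht, rfl⟩ := exists_eq_xVar hr
  rw [mul_add, ← mul_assoc, ← mul_assoc]
  exact N.add_mem (h 0 s hs) (h 1 t ht)

lemma mul_forms_succ_y_mem {N : Submodule ℂ BiPoly} {i j : ℕ} {p : BiPoly}
    (h : ∀ k, ∀ r ∈ forms i j, p * yVar k * r ∈ N) : ∀ r ∈ forms i (j + 1), p * r ∈ N := by
  intro r hr
  obtain ⟨s, hs, t, ht, rfl⟩ := exists_eq_yVar hr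
  rw [mul_add, ← mul_assoc, ← mul_assoc]
  exact N.add_mem (h 0 s hs) (h 1 t ht)

lemma mul_forms_zero_mem {N : Submodule ℂ BiPoly} {p : BiPoly} (h : p ∈ N) :
    ∀ r ∈ forms 0 0, p * r ∈ N := by
  intro r hr
  obtain ⟨c, rfl⟩ := exists_eq_C hr
  rw [mul_comm, ← smul_eq_C_mul]
  exact N.smul_mem c h

lemma stringMonomial_mem_range (S : Finset (Fin 4)) (x : Fin 4 → Fin 2) :
    stringMonomial S x ∈ LinearMap.range (toForm S) :=
  ⟨Pi.single x 1, by simp [toForm]⟩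

lemma forms_four_zero_le : forms 4 0 ≤ LinearMap.range (toForm ∅) := by
  intro q hq
  rw [← one_mul q]
  refine mul_forms_succ_x_mem (fun a => mul_forms_succ_x_mem fun b => mul_forms_succ_x_mem
    fun c => mul_forms_succ_x_mem fun d => mul_forms_zero_mem ?_) q hq
  convert stringMonomial_mem_range ∅ ![a, b, c, d] using 1
  simp [stringMonomial, Fin.prod_univ_four]

lemma forms_three_one_le : forms 3 1 ≤ LinearMap.range (toForm {0}) := by
  intro q hq
  rw [← one_mul q]
  refine mul_forms_succ_y_mem (fun a => mul_forms_succ_x_mem fun b => mul_forms_succ_x_mem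
    fun c => mul_forms_succ_x_mem fun d => mul_forms_zero_mem ?_) q hq
  convert stringMonomial_mem_range {0} ![a, b, c, d] using 1
  simp [stringMonomial, Fin.prod_univ_four]

lemma forms_two_two_le : forms 2 2 ≤ LinearMap.range (toForm {0, 1}) := by
  intro q hq
  rw [← one_mul q]
  refine mul_forms_succ_y_mem (fun a => mul_forms_succ_y_mem fun b => mul_forms_succ_x_mem
    fun c => mul_forms_succ_x_mem fun d => mul_forms_zero_mem ?_) q hq
  convert stringMonomial_mem_range {0, 1} ![a, b, c, d] using 1
  simp [stringMonomial, Fin.prod_univ_four]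

lemma toForm_mem_forms (S : Finset (Fin 4)) (v : (Fin 4 → Fin 2) → ℂ) :
    toForm S v ∈ forms (4 - S.card) S.card := by
  rw [toForm_apply]
  refine Submodule.sum_mem _ fun x _ => Submodule.smul_mem _ _ ?_
  have h : ∀ T : Finset (Fin 4), (∏ j ∈ T, if j ∈ S then yVar (x j) else xVar (x j)) ∈
      forms (T.filter (· ∉ S)).card (T.filter (· ∈ S)).card := by
    intro T
    induction T using Finset.induction_on with
    | empty => simpa using one_mem_forms
    | insert j T hj ih =>
      rw [Finset.prod_insert hj]
      by_cases hjS : j ∈ S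
      · rw [if_pos hjS]
        refine mul_mem_forms (yVar_mem_forms (x j)) ih ?_ ?_
        · rw [Finset.filter_insert, if_neg (by simpa using hjS), zero_add]
        · rw [Finset.filter_insert, if_pos hjS, Finset.card_insert_of_notMem (by simp [hj]),
            add_comm]
      · rw [if_neg hjS]
        refine mul_mem_forms (xVar_mem_forms (x j)) ih ?_ ?_
        · rw [Finset.filter_insert, if_pos hjS, Finset.card_insert_of_notMem (by simp [hj]),
            add_comm]
        · rw [Finset.filter_insert, if_neg hjS, zero_add]
  have h1 := h Finset.univ
  have h2 : (Finset.univ.filter (· ∈ S)).card = S.card := by simp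
  have h3 : (Finset.univ.filter (· ∉ S)).card = 4 - S.card := by
    have : Finset.univ.filter (· ∉ S) = Sᶜ := by ext; simp
    rw [this, Finset.card_compl, Fintype.card_fin]
  rwa [h2, h3] at h1

lemma mul_le_finrank_forms (i j : ℕ) : (i + 1) * (j + 1) ≤ Module.finrank ℂ (forms i j) := by
  let e : Fin (i + 1) × Fin (j + 1) → (Fin 2 ⊕ Fin 2 →₀ ℕ) := fun k =>
    Finsupp.single (Sum.inl 0) (k.1 : ℕ) + Finsupp.single (Sum.inl 1) (i - k.1) +
      (Finsupp.single (Sum.inr 0) (k.2 : ℕ) + Finsupp.single (Sum.inr 1) (j - k.2))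
  have he : Function.Injective e := by
    intro k k' h
    have h1 := DFunLike.congr_fun h (Sum.inl 0)
    have h2 := DFunLike.congr_fun h (Sum.inr 0)
    simp [e] at h1 h2
    exact Prod.ext (Fin.ext h1) (Fin.ext h2)
  have hmem : ∀ k, basisMonomials (Fin 2 ⊕ Fin 2) ℂ (e k) ∈ forms i j := by
    intro k
    have h1 : basisMonomials (Fin 2 ⊕ Fin 2) ℂ (e k) =
        (xVar 0 ^ (k.1 : ℕ) * xVar 1 ^ (i - k.1)) *
          (conj (xVar 0 ^ (k.2 : ℕ) * xVar 1 ^ (j - k.2))) := by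
      simp only [map_mul, map_pow, conj_xVar]
      simp only [coe_basisMonomials, e, xVar, yVar, X_pow_eq_monomial, monomial_mul, one_mul]
    rw [h1]
    have hx : ∀ a b : ℕ, xVar 0 ^ a * xVar 1 ^ b ∈ forms (a + b) 0 := fun a b =>
      mul_mem_forms (pow_mem_forms_x (xVar_mem_forms 0) a) (pow_mem_forms_x (xVar_mem_forms 1) b)
    exact mul_mem_forms (hx _ _) (conj_mem_forms (hx _ _))
      (by have := k.1.2; omega) (by have := k.2.2; omega)
  have hli : LinearIndependent ℂ (fun k => (⟨_, hmem k⟩ : forms i j)) :=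
    LinearIndependent.of_comp (forms i j).subtype
      ((basisMonomials (Fin 2 ⊕ Fin 2) ℂ).linearIndependent.comp e he)
  simpa using hli.fintype_card_le_finrank

/-- `toForm S` sends the kernel of the transposed matrix to annihilated forms and loses at most the
dimension of its own kernel. By rank–nullity at least dim (range of `toForm S`) minus the rank
survives. -/
lemma le_finrank_annForms {ρ : Op 4} (hρ : ρ.IsHermitian) (hsym : IsSymmetric ρ)
    {S : Finset (Fin 4)} {i j : ℕ} (hi : 4 - S.card = i) (hj : S.card = j)
    (hle : forms i j ≤ LinearMap.range (toForm S)) :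
    (i + 1) * (j + 1) ≤
      Module.finrank ℂ (annForms (momentFunctional ρ) i j) + (partialTranspose S ρ).rank := by
  set A := (partialTranspose S ρ).transpose with hA
  set N := LinearMap.ker A.mulVecLin with hN
  have hann : N.map (toForm S) ≤ annForms (momentFunctional ρ) i j := by
    rintro _ ⟨v, hv, rfl⟩
    refine ⟨by subst hi hj; exact toForm_mem_forms S v, fun p hp => ?_⟩
    have hS : S.card ≤ 4 := by simpa using Finset.card_le_univ S
    rw [show 4 - i = j by omega, show 4 - j = i by omega] at hp
    obtain ⟨w, hw⟩ := hle (conj_mem_forms hp)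
    have hv' : A.mulVec v = 0 := hv
    rw [← conj_conj p, ← hw, momentFunctional_toForm hρ hsym, Matrix.dotProduct_mulVec,
      ← Matrix.mulVec_transpose, ← hA, hv', zero_dotProduct]
  have h1 := LinearMap.finrank_range_add_finrank_ker A.mulVecLin
  have h2 := LinearMap.finrank_range_add_finrank_ker (toForm S)
  have h3 := LinearMap.finrank_range_add_finrank_ker ((toForm S).domRestrict N)
  have h4 : Module.finrank ℂ (LinearMap.ker ((toForm S).domRestrict N)) ≤
      Module.finrank ℂ (LinearMap.ker (toForm S)) := by
    refine LinearMap.finrank_le_finrank_of_injective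
      (f := (N.subtype.restrict (p := LinearMap.ker ((toForm S).domRestrict N))
        (q := LinearMap.ker (toForm S)) fun x hx => hx)) ?_
    intro x y hxy
    have h : (x.1.1 : (Fin 4 → Fin 2) → ℂ) = y.1.1 :=
      congrArg (fun t : LinearMap.ker (toForm S) => t.1) hxy
    exact Subtype.ext (Subtype.ext h)
  have h5 : Module.finrank ℂ (LinearMap.range ((toForm S).domRestrict N)) ≤
      Module.finrank ℂ (annForms (momentFunctional ρ) i j) := by
    refine Submodule.finrank_mono (le_trans ?_ hann)
    rintro _ ⟨v, rfl⟩
    exact ⟨v.1, v.2, rfl⟩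
  have h6 : (i + 1) * (j + 1) ≤ Module.finrank ℂ (LinearMap.range (toForm S)) :=
    (mul_le_finrank_forms i j).trans (Submodule.finrank_mono hle)
  have h7 : Module.finrank ℂ (LinearMap.range A.mulVecLin) = (partialTranspose S ρ).rank := by
    rw [← Matrix.rank_transpose (partialTranspose S ρ), Matrix.rank]
  rw [← hN] at h1
  omega

lemma isPPTFunctional_momentFunctional {ρ : Op 4} (hρ : IsPPTState ρ) (hsym : IsSymmetric ρ) :
    IsPPTFunctional (momentFunctional ρ) := by
  have hH : ρ.IsHermitian := hρ.1.1.isHermitian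
  have key : ∀ S : Finset (Fin 4), ∀ q ∈ LinearMap.range (toForm S),
      0 ≤ (momentFunctional ρ (q * conj q)).re := by
    rintro S _ ⟨v, rfl⟩
    rw [momentFunctional_toForm hH hsym]
    have := (hρ.2 S).dotProduct_mulVec_nonneg (star v)
    rw [star_star] at this
    exact (Complex.nonneg_iff.1 this).1
  refine ⟨momentFunctional_conj hH, fun i j hij hj q hq => ?_⟩
  interval_cases j
  · obtain rfl : i = 4 := by omega
    exact key ∅ q (forms_four_zero_le hq)
  · obtain rfl : i = 3 := by omega
    exact key {0} q (forms_three_one_le hq)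
  · obtain rfl : i = 2 := by omega
    exact key {0, 1} q (forms_two_two_le hq)

lemma partialTranspose_empty (ρ : Op 4) : partialTranspose ∅ ρ = ρ := by
  ext x y; simp [partialTranspose]

lemma isDegenerate_momentFunctional {ρ : Op 4} (hρ : IsPPTState ρ) (hsym : IsSymmetric ρ)
    (h : rk ρ ≤ 4 ∨ rkA ρ ≤ 6 ∨ rkAB ρ ≤ 6) : IsDegenerate (momentFunctional ρ) := by
  have hH : ρ.IsHermitian := hρ.1.1.isHermitian
  rcases h with h | h | h
  · have := le_finrank_annForms hH hsym (S := ∅) (i := 4) (j := 0) rfl rfl forms_four_zero_le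
    rw [partialTranspose_empty] at this
    rw [rk] at h
    exact Or.inl (by omega)
  · have := le_finrank_annForms hH hsym (S := {0}) (i := 3) (j := 1) rfl rfl forms_three_one_le
    rw [rkA] at h
    exact Or.inr (Or.inl (by omega))
  · have := le_finrank_annForms hH hsym (S := {0, 1}) (i := 2) (j := 2) rfl rfl forms_two_two_le
    rw [rkAB] at h
    exact Or.inr (Or.inr (by omega))

/-! ### Evaluations as product states, and separability -/

lemma trace_tensor {N : ℕ} (σ : Fin N → Matrix (Fin 2) (Fin 2) ℂ) :
    (tensor σ).trace = ∏ j, (σ j).trace := by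
  simp only [Matrix.trace, tensor, Matrix.diag_apply, Matrix.of_apply]
  rw [Finset.prod_univ_sum]
  simp [Fintype.piFinset_univ]

/-- The projector onto the line through `z`. -/
noncomputable def pureState (z : Fin 2 → ℂ) : Matrix (Fin 2) (Fin 2) ℂ :=
  ((∑ k, Complex.normSq (z k))⁻¹ : ℝ) • Matrix.vecMulVec z (star z)

lemma sum_normSq_pos {z : Fin 2 → ℂ} (hz : z ≠ 0) : 0 < ∑ k, Complex.normSq (z k) := by
  obtain ⟨k, hk⟩ := Function.ne_iff.1 hz
  exact Finset.sum_pos' (fun k _ => Complex.normSq_nonneg _)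
    ⟨k, Finset.mem_univ k, Complex.normSq_pos.2 hk⟩

lemma isState_pureState {z : Fin 2 → ℂ} (hz : z ≠ 0) : IsState (pureState z) := by
  have hpos := sum_normSq_pos hz
  refine ⟨(Matrix.posSemidef_vecMulVec_self_star z).smul (inv_nonneg.2 hpos.le), ?_⟩
  have h1 : (Matrix.vecMulVec z (star z)).trace = ((∑ k, Complex.normSq (z k) : ℝ) : ℂ) := by
    rw [Matrix.trace_vecMulVec, dotProduct]
    push_cast
    exact Finset.sum_congr rfl fun k _ => Complex.mul_conj (z k)
  rw [pureState, Matrix.trace_smul, h1, Complex.real_smul, ← Complex.ofReal_mul,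
    inv_mul_cancel₀ hpos.ne', Complex.ofReal_one]

lemma evalAt_prod {z : Fin 2 → ℂ} (hz : z ≠ 0) (s t : Fin 4 → Fin 2) :
    evalAt z ((∏ j, xVar (s j)) * ∏ j, yVar (t j)) =
      (((∑ k, Complex.normSq (z k)) ^ 4 : ℝ) : ℂ) * tensor (fun _ : Fin 4 => pureState z) s t := by
  have hpos : ((∑ k, Complex.normSq (z k) : ℝ) : ℂ) ≠ 0 := by
    exact_mod_cast (sum_normSq_pos hz).ne'
  set n := ∑ k, Complex.normSq (z k)
  have h1 : ∀ j, pureState z (s j) (t j) = (n : ℂ)⁻¹ * (z (s j) * star (z (t j))) := by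
    intro j
    simp [pureState, Matrix.vecMulVec_apply, n]
  rw [tensor, Matrix.of_apply]
  simp only [h1, Finset.prod_mul_distrib, map_mul, map_prod, evalAt_xVar, evalAt_yVar,
    Finset.prod_const, Finset.card_univ, Fintype.card_fin]
  push_cast
  field_simp

/-- A PPT symmetric four-qubit state with `r(ρ) ≤ 4`, `r(ρ^{T_A}) ≤ 6` or `r(ρ^{T_AB}) ≤ 6`
is fully separable. -/
theorem fullySeparable_of_rank_le {ρ : Op 4} (hρ : ρ ∈ pptSymmetricStates 4)
    (h : rk ρ ≤ 4 ∨ rkA ρ ≤ 6 ∨ rkAB ρ ≤ 6) : FullySeparable ρ := by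
  obtain ⟨hP, hsym⟩ := hρ
  have hH : ρ.IsHermitian := hP.1.1.isHermitian
  obtain ⟨n, c, z, hc, hz, e⟩ := (isPPTFunctional_momentFunctional hP hsym).exists_eq_sum_evalAt
    (isDegenerate_momentFunctional hP hsym h)
  have hsum : ρ = ∑ k, ((c k * (∑ i, Complex.normSq (z k i)) ^ 4 : ℝ) : ℂ) •
      tensor (fun _ : Fin 4 => pureState (z k)) := by
    ext s t
    have hx : ∏ j, xVar (s j) ∈ forms 4 0 := by
      simpa using prod_mem_forms Finset.univ fun j => xVar_mem_forms (s j)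
    have hy : ∏ j, yVar (t j) ∈ forms 0 4 := by
      have := conj_mem_forms (prod_mem_forms Finset.univ fun j => xVar_mem_forms (t j))
      simpa [map_prod] using this
    rw [← momentFunctional_prod hH hsym s t, e _ (mul_mem_forms hx hy), Matrix.sum_apply]
    refine Finset.sum_congr rfl fun k _ => ?_
    rw [evalAt_prod (hz k), Matrix.smul_apply, smul_eq_mul, Complex.ofReal_mul, mul_assoc]
  refine ⟨n, fun k => c k * (∑ i, Complex.normSq (z k i)) ^ 4, fun k _ => pureState (z k),
    fun k => mul_nonneg (hc k) (pow_nonneg (sum_normSq_pos (hz k)).le 4), ?_,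
    fun k _ => isState_pureState (hz k), hsum⟩
  -- Taking traces in the decomposition shows that the weights sum to one.
  have htr := hP.1.2
  rw [hsum, Matrix.trace_sum] at htr
  have h1 : ∀ k, (tensor (fun _ : Fin 4 => pureState (z k))).trace = 1 := fun k => by
    rw [trace_tensor]
    exact Finset.prod_eq_one fun _ _ => (isState_pureState (hz k)).2
  simp only [Matrix.trace_smul, h1, smul_eq_mul, mul_one] at htr
  exact_mod_cast htr

/-- The polynomial 1 excludes nothing. -/
lemma holdsGenerically_of_forall {I : Type*} {X : Set (Matrix I I ℂ)} {P : Matrix I I ℂ → Prop}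
    (h : ∀ ρ ∈ X, P ρ) : HoldsGenerically X P :=
  ⟨1, fun ρ hρ => subset_closure ⟨hρ, by simp⟩, fun ρ hρ _ => h ρ hρ⟩

end QubitStates

open QubitStates in
theorem theorem1 :
    (∀ ρ ∈ pptSymmetricStates 4, rk ρ ≤ 4 ∨ rkA ρ ≤ 4 ∨ rkAB ρ ≤ 3 → FullySeparable ρ) ∧
    HoldsGenerically {ρ | ρ ∈ pptSymmetricStates 4 ∧ rkA ρ ≤ 6} FullySeparable ∧
    HoldsGenerically {ρ | ρ ∈ pptSymmetricStates 4 ∧ rkAB ρ ≤ 6} FullySeparable ∧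
    (∀ a b c : ℕ, b ≤ 6 ∨ c ≤ 6 →
      HoldsGenerically
        {ρ | ρ ∈ pptSymmetricStates 4 ∧ rk ρ = a ∧ rkA ρ = b ∧ rkAB ρ = c}
        FullySeparable) := by
  refine ⟨fun ρ hρ h => fullySeparable_of_rank_le hρ ?_,
    holdsGenerically_of_forall fun ρ hρ => fullySeparable_of_rank_le hρ.1 (Or.inr (Or.inl hρ.2)),
    holdsGenerically_of_forall fun ρ hρ => fullySeparable_of_rank_le hρ.1 (Or.inr (Or.inr hρ.2)),
    fun a b c h => holdsGenerically_of_forall fun ρ hρ => fullySeparable_of_rank_le hρ.1 ?_⟩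
  · rcases h with h | h | h
    exacts [Or.inl h, Or.inr (Or.inl (by omega)), Or.inr (Or.inr (by omega))]
  · obtain ⟨-, -, h2, h3⟩ := hρ
    rw [h2, h3]
    exact Or.inr h
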